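/- Let $M$ be a smooth ($C^\infty$) finite-dimensional Hausdorff manifold without boundary, and let $\Gamma$ be a real normed vector space (for instance any finite-dimensional vector space). A \emph{nearly-periodic map} on $M$ with parameter space $\Gamma$ is a smooth map $F:M\times\Gamma\to M$ such that each $F_\gamma=F(\cdot,\gamma)$ is a diffeomorphism of $M$, together with a smooth $U(1)$-action $\Phi_\theta:M\to M$ and an angle $\theta_0$ such that $F_0=\Phi_{\theta_0}$. It is \emph{non-resonant} if $\theta_0$ is not a rational multiple of $2\pi$. The \emph{limiting roto-rate} is the infinitesimal generator $R_0=\frac{d}{d\theta}\big|_{\theta=0}\Phi_\theta$. A \emph{roto-rate} for $F$ is a formal power series $R_\gamma=R_0+R_1[\gamma]+R_2[\gamma,\gamma]+\cdots$, whose coefficients are homogeneous polynomial maps from $\Gamma$ into the smooth vector fields on $M$, such that $R_0$ is the limiting roto-rate, and, in the sense of formal power series in $\gamma$, $F_\gamma^*R_\gamma=R_\gamma$ (with $F_\gamma^*$ replaced by its Taylor expansion at $\gamma=0$) and $\exp(2\pi\mathcal L_{R_\gamma})=1$. Here, for smooth $f:M\to\mathbb R$, $\exp(t\mathcal L_{R_\gamma})f$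 denotes the formal power series $u_t$ that solves $\partial_t u_t=\mathcal L_{R_\gamma}u_t$, $u_0=f$, order by order in $\gamma$. Let $\Omega_\gamma$ be a $2$-form on $M$ that depends smoothly on $(m,\gamma)\in M\times\Gamma$ and satisfies $\mathbf d\Omega_\gamma=0$ for each $\gamma\in\Gamma$. \textbf{Theorem (Roto-rate is presymplectic).} Let $F$ be a non-resonant nearly-periodic map on $M$ with parameter space $\Gamma$ that is presymplectic, i.e. $F_\gamma^*\Omega_\gamma=\Omega_\gamma$ for each $\gamma\in\Gamma$, and let $R_\gamma$ be a roto-rate for $F$. Then $\mathcal L_{R_\gamma}\Omega_\gamma=0$ in the sense of formal power series: if $\Omega_0+\Omega_1[\gamma]+\Omega_2[\gamma,\gamma]+\cdots$ is the Taylor series of $\gamma\mapsto\Omega_\gamma$ at $\gamma=0$, then for every $n\ge 0$ and $\gamma\in\Gamma$ $$\sum_{k+j=n}\mathcal L_{R_k[\gamma,\dots,\gamma]}\,\Omega_j[\gamma,\dots,\gamma]=0 .$$ -/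

import Mathlib

open scoped Manifold ContDiff Bundle Nat

noncomputable section

namespace NearlyPeriodic

variable {E : Type*} [NormedAddCommGroup E] [NormedSpace ℝ E]
  {H : Type*} [TopologicalSpace H] (I : ModelWithCorners ℝ E H)
  (M : Type*) [TopologicalSpace M] [ChartedSpace H M]
  (Γ : Type*) [NormedAddCommGroup Γ] [NormedSpace ℝ Γ]

/-- A smooth action of the circle `U(1) = ℝ / 2πℤ` on `M`, written as a `2π`-periodic smooth
action `θ ↦ Φ_θ` of the additive group of angles. -/
structure CircleAction where
  toFun : ℝ → M → M
  smooth : ContMDiff (𝓘(ℝ, ℝ).prod I) I ∞ (fun p : ℝ × M => toFun p.1 p.2)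
  map_zero : ∀ m, toFun 0 m = m
  map_add : ∀ s t m, toFun (s + t) m = toFun s (toFun t m)
  map_two_pi : ∀ m, toFun (2 * Real.pi) m = m

/-- A nearly-periodic map on `M` with parameter space `Γ`: a smooth map `F : M × Γ → M` such that
every `F_γ` is a diffeomorphism and `F_0 = Φ_{θ₀}` for a circle action `Φ` and an angle `θ₀`. -/
structure NearlyPeriodicMap where
  toFun : M × Γ → M
  smooth : ContMDiff (I.prod 𝓘(ℝ, Γ)) I ∞ toFun
  diffeo : ∀ γ : Γ, ∃ g : Diffeomorph I I M M ∞, ∀ m, g m = toFun (m, γ)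
  action : CircleAction I M
  angle : ℝ
  map_zero : ∀ m, toFun (m, 0) = action.toFun angle m

/-- Smooth vector fields on `M`. -/
abbrev SmoothVectorField [IsManifold I ∞ M] : Type _ :=
  Cₛ^∞⟮I; E, fun x : M => TangentSpace I x⟯

/-- Formal power series `X_γ = X_0 + X_1[γ] + X_2[γ, γ] + ⋯` in `γ ∈ Γ` whose coefficients are
homogeneous polynomial maps from `Γ` into smooth vector fields; the `k`-th term is given by a
`k`-linear map. -/
abbrev FormalVectorField [IsManifold I ∞ M] : Type _ :=
  (k : ℕ) → MultilinearMap ℝ (fun _ : Fin k => Γ) (SmoothVectorField I M)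

variable {I M Γ}

namespace NearlyPeriodicMap

/-- The map `F_γ : M → M`. -/
def at' (F : NearlyPeriodicMap I M Γ) (γ : Γ) : M → M := fun m => F.toFun (m, γ)

/-- `F` is non-resonant when `θ₀` is not a rational multiple of `2π`. -/
def NonResonant (F : NearlyPeriodicMap I M Γ) : Prop :=
  ¬ ∃ q : ℚ, F.angle = (q : ℝ) * (2 * Real.pi)

end NearlyPeriodicMap

/-- `X` is the infinitesimal generator of the circle action `Φ`:
`X(m) = d/dθ|_{θ = 0} Φ_θ(m)` for every `m` (recall `Φ_0(m) = m`). -/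
def IsInfinitesimalGenerator (Φ : CircleAction I M) (X : (m : M) → TangentSpace I m) : Prop :=
  ∀ m, HasMFDerivAt 𝓘(ℝ, ℝ) I (fun θ : ℝ => Φ.toFun θ m) 0
    ((1 : ℝ →L[ℝ] ℝ).smulRight (X (Φ.toFun 0 m)))

/-- The derivative `X f = L_X f` of a function `f` along a vector field `X`. -/
def dirDeriv (X : (m : M) → TangentSpace I m) (f : M → ℝ) (m : M) : ℝ :=
  mfderiv I 𝓘(ℝ, ℝ) f m (X m)

variable [IsManifold I ∞ M]

/-- The homogeneous term `X_k[γ, …, γ]` of a formal power series, as a vector field. -/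
def FormalVectorField.term (X : FormalVectorField I M Γ) (k : ℕ) (γ : Γ) :
    (m : M) → TangentSpace I m :=
  fun m => X k (fun _ => γ) m

/-- The `j`-th order term in `γ` of the Taylor expansion at `γ = 0` of `γ ↦ (F_γ^* X)(m)`, where
`X` is a fixed vector field and `F_γ^* X = (T F_γ)⁻¹ ∘ X ∘ F_γ`. -/
def pullbackTerm (F : NearlyPeriodicMap I M Γ) (X : (m : M) → TangentSpace I m) (j : ℕ) (γ : Γ)
    (m : M) : TangentSpace I m :=
  ((j ! : ℝ)⁻¹ • iteratedDeriv (F := E) j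
    (fun s : ℝ => (VectorField.mpullback I I (F.at' (s • γ)) X m : E)) 0 : E)

/-- `F_γ^* R_γ = R_γ` in the sense of formal power series: the term of order `n` of
`F_γ^* R_γ`, which is the sum over `j + k = n` of the terms of order `j` of `F_γ^*` applied to
`R_k[γ, …, γ]`, equals `R_n[γ, …, γ]`. -/
def FormallyInvariant (F : NearlyPeriodicMap I M Γ) (R : FormalVectorField I M Γ) : Prop :=
  ∀ (n : ℕ) (γ : Γ) (m : M),
    ∑ p ∈ Finset.HasAntidiagonal.antidiagonal n, pullbackTerm F (R.term p.2 γ) p.1 γ m = R.term n γ m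

/-- `u_t = ∑ n, u n t` is the formal power series `exp(t L_{R_γ}) f` (with `u n t` its term of
order `n` at `γ`), for a smooth function `f`. That is, `u` is the smooth solution of
`∂_t u_t = L_{R_γ} u_t`, `u_0 = f`, order by order in `γ`. When `R_0` is complete this solution
exists and is unique, because at order `n` the equation is a linear transport equation along `R_0`
whose source involves lower orders only. -/
structure IsFormalExp (R : FormalVectorField I M Γ) (γ : Γ) (f : M → ℝ) (u : ℕ → ℝ → M → ℝ) :
    Prop where
  smooth : ∀ n, ContMDiff (𝓘(ℝ, ℝ).prod I) 𝓘(ℝ, ℝ) ∞ (fun p : ℝ × M => u n p.1 p.2)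
  init_zero : ∀ m, u 0 0 m = f m
  init_pos : ∀ n, 0 < n → ∀ m, u n 0 m = 0
  evolution : ∀ n t m, HasDerivAt (fun s => u n s m)
    (∑ p ∈ Finset.HasAntidiagonal.antidiagonal n, dirDeriv (R.term p.1 γ) (u p.2 t) m) t

/-- `exp(2π L_{R_γ}) = 1` in the sense of formal power series (as operators on functions). -/
def ExpTwoPiEqOne (R : FormalVectorField I M Γ) : Prop :=
  ∀ (γ : Γ) (f : M → ℝ), ContMDiff I 𝓘(ℝ, ℝ) ∞ f →
    ∃ u : ℕ → ℝ → M → ℝ, IsFormalExp R γ f u ∧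
      (∀ m, u 0 (2 * Real.pi) m = f m) ∧ ∀ n, 0 < n → ∀ m, u n (2 * Real.pi) m = 0

/-- `R_γ` is a roto-rate for the nearly-periodic map `F`. -/
structure IsRotoRate (F : NearlyPeriodicMap I M Γ) (R : FormalVectorField I M Γ) : Prop where
  limiting : ∀ γ : Γ, IsInfinitesimalGenerator F.action (R.term 0 γ)
  invariant : FormallyInvariant F R
  periodic : ExpTwoPiEqOne R

variable (I M) in
/-- Tensor fields on `M` that are sections of `T^*M ⊗ T^*M`. -/
abbrev TwoTensor : Type _ := (m : M) → TangentSpace I m →L[ℝ] TangentSpace I m →L[ℝ] ℝ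

/-- The `2`-form `τ` is closed: `dτ(X, Y, Z) = 0` for all smooth vector fields `X, Y, Z`. -/
def IsClosedForm (τ : TwoTensor I M) : Prop :=
  ∀ (X Y Z : SmoothVectorField I M) (m : M),
    dirDeriv X (fun x => τ x (Y x) (Z x)) m
      - dirDeriv Y (fun x => τ x (X x) (Z x)) m
      + dirDeriv Z (fun x => τ x (X x) (Y x)) m
      - τ m (VectorField.mlieBracket I X Y m) (Z m)
      + τ m (VectorField.mlieBracket I X Z m) (Y m)
      - τ m (VectorField.mlieBracket I Y Z m) (X m) = 0

variable (I M Γ) in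
/-- A smooth `γ`-dependent presymplectic form `Ω_γ` on `M`, i.e. a `2`-form depending smoothly on
`(m, γ) ∈ M × Γ` with `dΩ_γ = 0` for each `γ`. -/
structure PresymplecticForm where
  form : Γ → TwoTensor I M
  alternating : ∀ γ m (v : TangentSpace I m), form γ m v v = 0
  smooth : ContMDiff (I.prod 𝓘(ℝ, Γ)) (I.prod 𝓘(ℝ, E →L[ℝ] E →L[ℝ] ℝ)) ∞
    (fun p : M × Γ => Bundle.TotalSpace.mk' (E →L[ℝ] E →L[ℝ] ℝ)
      (E := fun m : M => TangentSpace I m →L[ℝ] TangentSpace I m →L[ℝ] ℝ) p.1 (form p.2 p.1))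
  closed : ∀ γ, IsClosedForm (form γ)

/-- The term of order `j` in `γ` of the Taylor expansion of `γ ↦ Ω_γ` at `γ = 0`. -/
def PresymplecticForm.term (Ω : PresymplecticForm I M Γ) (j : ℕ) (γ : Γ) : TwoTensor I M :=
  fun m => ((j ! : ℝ)⁻¹ • iteratedDeriv (F := E →L[ℝ] E →L[ℝ] ℝ) j
    (fun s : ℝ => (Ω.form (s • γ) m : E →L[ℝ] E →L[ℝ] ℝ)) 0 : E →L[ℝ] E →L[ℝ] ℝ)

/-- `F` is presymplectic: `F_γ^* Ω_γ = Ω_γ` for each `γ`. -/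
def IsPresymplecticMap (F : NearlyPeriodicMap I M Γ) (Ω : PresymplecticForm I M Γ) : Prop :=
  ∀ (γ : Γ) (m : M) (v w : TangentSpace I m),
    Ω.form γ (F.at' γ m) (mfderiv I I (F.at' γ) m v) (mfderiv I I (F.at' γ) m w)
      = Ω.form γ m v w

/-- The function `(L_X τ)(Y, Z)`, for the Lie derivative `L_X τ` of a tensor field `τ` with two
covariant slots:
`(L_X τ)(Y, Z) = X (τ(Y, Z)) - τ([X, Y], Z) - τ(Y, [X, Z])`. -/
def lieDeriv (X : (m : M) → TangentSpace I m) (τ : TwoTensor I M) (Y Z : SmoothVectorField I M)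
    (m : M) : ℝ :=
  dirDeriv X (fun x => τ x (Y x) (Z x)) m
    - τ m (VectorField.mlieBracket I X Y m) (Z m)
    - τ m (Y m) (VectorField.mlieBracket I X Z m)

/-- `L_{R_γ} Ω_γ = 0` as a formal power series in `γ`, where `Ω_γ` is replaced by its Taylor series
at `γ = 0`: for every `n`, the term of order `n`, which is the sum of
`L_{R_k[γ, …, γ]} Ω_j[γ, …, γ]` over `k + j = n`, is the zero `2`-form. -/
def FormalLieDerivEqZero (R : FormalVectorField I M Γ) (Ω : PresymplecticForm I M Γ) : Prop :=
  ∀ (n : ℕ) (γ : Γ) (Y Z : SmoothVectorField I M) (m : M),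
    ∑ p ∈ Finset.HasAntidiagonal.antidiagonal n, lieDeriv (R.term p.1 γ) (Ω.term p.2 γ) Y Z m = 0

end NearlyPeriodic

end

noncomputable section

namespace NearlyPeriodic

variable {E : Type*} [NormedAddCommGroup E] [NormedSpace ℝ E]
  {H : Type*} [TopologicalSpace H] {I : ModelWithCorners ℝ E H}
  {M : Type*} [TopologicalSpace M] [ChartedSpace H M]
  {Γ : Type*} [NormedAddCommGroup Γ] [NormedSpace ℝ Γ]

section Families

variable {E' : Type*} [NormedAddCommGroup E'] [NormedSpace ℝ E']

variable (I) in
/-- A family of real functions on `M`, smooth jointly in the parameter and the point. -/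
def SmoothFamily (h : ℝ → M → ℝ) : Prop :=
  ContMDiff (𝓘(ℝ, ℝ).prod I) 𝓘(ℝ, ℝ) ∞ (fun p : ℝ × M => h p.1 p.2)

variable (I) in
/-- A family of functions read in the extended chart at `x₀`. -/
def chartFamily (h : ℝ → M → E') (x₀ : M) (p : ℝ × E) : E' :=
  h p.1 ((extChartAt I x₀).symm p.2)

theorem SmoothFamily.contMDiff {h : ℝ → M → ℝ} (hh : SmoothFamily I h) (s : ℝ) :
    ContMDiff I 𝓘(ℝ, ℝ) ∞ (h s) :=
  hh.comp (contMDiff_const.prodMk contMDiff_id)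

theorem SmoothFamily.contDiff {h : ℝ → M → ℝ} (hh : SmoothFamily I h) (x : M) :
    ContDiff ℝ ∞ (fun s => h s x) :=
  (hh.comp (contMDiff_id.prodMk contMDiff_const : ContMDiff 𝓘(ℝ, ℝ) _ ∞ fun s : ℝ => (s, x))).contDiff

theorem SmoothFamily.comp {h : ℝ → M → ℝ} (hh : SmoothFamily I h) {G : ℝ → M → M}
    (hG : ContMDiff (𝓘(ℝ, ℝ).prod I) I ∞ (fun p : ℝ × M => G p.1 p.2)) :
    SmoothFamily I (fun s x => h s (G s x)) :=
  ContMDiff.comp hh (contMDiff_fst.prodMk hG)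

theorem smoothFamily_const {g : M → ℝ} (hg : ContMDiff I 𝓘(ℝ, ℝ) ∞ g) :
    SmoothFamily I (fun _ => g) :=
  hg.comp contMDiff_snd

theorem contDiffAt_infty_fderiv {V W : Type*} [NormedAddCommGroup V] [NormedSpace ℝ V]
    [NormedAddCommGroup W] [NormedSpace ℝ W] {f : V → W} {x : V} (hf : ContDiffAt ℝ ∞ f x) :
    ContDiffAt ℝ ∞ (fderiv ℝ f) x :=
  hf.fderiv_right (m := ∞) (by simp)

theorem mfderiv_eq_fderiv_chart [I.Boundaryless] {f : M → E'} {x : M} (hf : MDifferentiableAt I 𝓘(ℝ, E') f x)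
    (v : TangentSpace I x) :
    (mfderiv I 𝓘(ℝ, E') f x v : E') =
      fderiv ℝ (fun y => f ((extChartAt I x).symm y)) (extChartAt I x x) (v : E) := by
  have key : ∀ L : E →L[ℝ] E', HasFDerivWithinAt (fun y => f ((extChartAt I x).symm y)) L
      (Set.range I) (extChartAt I x x) → ∀ v : E, L v =
      fderiv ℝ (fun y => f ((extChartAt I x).symm y)) (extChartAt I x x) v := by
    intro L hL v
    rw [I.range_eq_univ, hasFDerivWithinAt_univ] at hL
    rw [hL.fderiv]
  exact key _ hf.hasMFDerivAt.2 v

theorem chartFamily_fderiv_fst {h : ℝ → M → E'} {x₀ : M} {s : ℝ} {y : E}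
    (hd : DifferentiableAt ℝ (chartFamily I h x₀) (s, y)) :
    HasDerivAt (fun s => h s ((extChartAt I x₀).symm y))
      (fderiv ℝ (chartFamily I h x₀) (s, y) (1, 0)) s := by
  have h1 : HasDerivAt (fun s : ℝ => (s, y)) ((1 : ℝ), (0 : E)) s :=
    (hasDerivAt_id s).prodMk (hasDerivAt_const s y)
  exact hd.hasFDerivAt.comp_hasDerivAt s h1

theorem chartFamily_fderiv_snd {h : ℝ → M → E'} {x₀ : M} {s : ℝ} {y : E}
    (hd : DifferentiableAt ℝ (chartFamily I h x₀) (s, y)) :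
    HasFDerivAt (fun y => h s ((extChartAt I x₀).symm y))
      ((fderiv ℝ (chartFamily I h x₀) (s, y)).comp (ContinuousLinearMap.inr ℝ ℝ E)) y := by
  have h1 : HasFDerivAt (fun y : E => (s, y)) (ContinuousLinearMap.inr ℝ ℝ E) y :=
    hasFDerivAt_prodMk_right s y
  exact hd.hasFDerivAt.comp y h1

variable [I.Boundaryless] [IsManifold I ∞ M]

theorem contDiffAt_chartFamily {h : ℝ → M → E'} {x₀ x : M} (hx : x ∈ (extChartAt I x₀).source)
    {s : ℝ} (hh : ContMDiffAt (𝓘(ℝ, ℝ).prod I) 𝓘(ℝ, E') ∞ (fun p : ℝ × M => h p.1 p.2) (s, x)) :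
    ContDiffAt ℝ ∞ (chartFamily I h x₀) (s, extChartAt I x₀ x) := by
  have hsymm : ContMDiffAt 𝓘(ℝ, E) I ∞ (extChartAt I x₀).symm (extChartAt I x₀ x) :=
    (contMDiffOn_extChartAt_symm x₀).contMDiffAt
      ((isOpen_extChartAt_target x₀).mem_nhds ((extChartAt I x₀).map_source hx))
  have hpair : ContMDiffAt 𝓘(ℝ, ℝ × E) (𝓘(ℝ, ℝ).prod I) ∞
      (fun p : ℝ × E => (p.1, (extChartAt I x₀).symm p.2)) (s, extChartAt I x₀ x) := by
    refine contDiff_fst.contMDiff.contMDiffAt.prodMk ?_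
    exact ContMDiffAt.comp (s, extChartAt I x₀ x) hsymm contDiff_snd.contMDiff.contMDiffAt
  refine ContMDiffAt.contDiffAt ?_
  refine ContMDiffAt.comp (s, extChartAt I x₀ x) (g := fun p : ℝ × M => h p.1 p.2) ?_ hpair
  rw [← (extChartAt I x₀).left_inv hx] at hh
  exact hh

theorem mfderiv_family_eq {h : ℝ → M → E'} {x : M} {s : ℝ}
    (hh : ContMDiffAt (𝓘(ℝ, ℝ).prod I) 𝓘(ℝ, E') ∞ (fun p : ℝ × M => h p.1 p.2) (s, x))
    (v : TangentSpace I x) :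
    (mfderiv I 𝓘(ℝ, E') (h s) x v : E') =
      fderiv ℝ (chartFamily I h x) (s, extChartAt I x x) ((0 : ℝ), (v : E)) := by
  have h1 : MDifferentiableAt I 𝓘(ℝ, E') (h s) x := by
    have : ContMDiffAt I 𝓘(ℝ, E') ∞ (h s) x :=
      ContMDiffAt.comp x (g := fun p : ℝ × M => h p.1 p.2) (f := fun x => (s, x)) hh
        (contMDiffAt_const.prodMk contMDiffAt_id)
    exact this.mdifferentiableAt (by simp)
  rw [mfderiv_eq_fderiv_chart h1, (chartFamily_fderiv_snd
    ((contDiffAt_chartFamily (mem_extChartAt_source x) hh).differentiableAt (by simp))).fderiv]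
  rfl

theorem contDiffAt_mfderiv_family {h : ℝ → M → E'} {x : M} {s₀ : ℝ}
    (hh : ∀ᶠ s in nhds s₀,
      ContMDiffAt (𝓘(ℝ, ℝ).prod I) 𝓘(ℝ, E') ∞ (fun p : ℝ × M => h p.1 p.2) (s, x))
    (v : TangentSpace I x) :
    ContDiffAt ℝ ∞ (fun s => (mfderiv I 𝓘(ℝ, E') (h s) x v : E')) s₀ := by
  have h1 : ContDiffAt ℝ ∞ (fun s : ℝ => fderiv ℝ (chartFamily I h x) (s, extChartAt I x x)
      ((0 : ℝ), (v : E))) s₀ := by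
    have h2 := contDiffAt_infty_fderiv
      (contDiffAt_chartFamily (mem_extChartAt_source x) hh.self_of_nhds)
    have h3 : ContDiffAt ℝ ∞ (fun s : ℝ => (s, extChartAt I x x)) s₀ :=
      contDiffAt_id.prodMk contDiffAt_const
    exact (ContDiffAt.comp s₀ h2 h3).clm_apply contDiffAt_const
  refine h1.congr_of_eventuallyEq ?_
  filter_upwards [hh] with s hs using mfderiv_family_eq hs v

theorem SmoothFamily.contDiff_mfderiv {h : ℝ → M → ℝ} (hh : SmoothFamily I h) (x : M)
    (v : TangentSpace I x) :
    ContDiff ℝ ∞ (fun s => (mfderiv I 𝓘(ℝ, ℝ) (h s) x v : ℝ)) :=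
  contDiff_iff_contDiffAt.2 fun _ =>
    contDiffAt_mfderiv_family (.of_forall fun _ => hh.contMDiffAt) v

theorem SmoothFamily.deriv {h : ℝ → M → ℝ} (hh : SmoothFamily I h) :
    SmoothFamily I (fun s x => deriv (fun s => h s x) s) := by
  rintro ⟨s₀, x₀⟩
  have h1 : ContMDiffAt (𝓘(ℝ, ℝ).prod I) 𝓘(ℝ, ℝ) ∞ (fun p : ℝ × M =>
      fderiv ℝ (chartFamily I h x₀) (p.1, extChartAt I x₀ p.2) ((1 : ℝ), (0 : E))) (s₀, x₀) := by
    have h2 := contDiffAt_infty_fderiv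
      (contDiffAt_chartFamily (mem_extChartAt_source x₀) (hh.contMDiffAt (x := (s₀, x₀))))
    have h3 : ContMDiffAt (𝓘(ℝ, ℝ).prod I) 𝓘(ℝ, ℝ × E) ∞
        (fun p : ℝ × M => (p.1, extChartAt I x₀ p.2)) (s₀, x₀) :=
      contMDiffAt_fst.prodMk_space
        (ContMDiffAt.comp (s₀, x₀) contMDiffAt_extChartAt contMDiffAt_snd)
    exact ((h2.clm_apply contDiffAt_const).contMDiffAt).comp (s₀, x₀) h3
  refine h1.congr_of_eventuallyEq ?_
  have hev : ∀ᶠ p : ℝ × M in nhds (s₀, x₀), p.2 ∈ (extChartAt I x₀).source :=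
    continuous_snd.continuousAt.eventually
      ((isOpen_extChartAt_source x₀).mem_nhds (mem_extChartAt_source x₀))
  filter_upwards [hev] with p hp
  have := (chartFamily_fderiv_fst ((contDiffAt_chartFamily hp
    (hh.contMDiffAt (x := (p.1, p.2)))).differentiableAt (by simp))).deriv
  rwa [(extChartAt I x₀).left_inv hp] at this

theorem SmoothFamily.hasDerivAt_mfderiv {h : ℝ → M → ℝ} (hh : SmoothFamily I h) (s : ℝ) (x : M)
    (v : TangentSpace I x) :
    HasDerivAt (fun s => (mfderiv I 𝓘(ℝ, ℝ) (h s) x v : ℝ))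
      (mfderiv I 𝓘(ℝ, ℝ) (fun y => _root_.deriv (fun s => h s y) s) x v : ℝ) s := by
  set y₀ := extChartAt I x x
  have hC : ∀ y ∈ (extChartAt I x).target, ∀ s, ContDiffAt ℝ ∞ (chartFamily I h x) (s, y) := by
    intro y hy s
    have := contDiffAt_chartFamily ((extChartAt I x).map_target hy)
      (hh.contMDiffAt (x := (s, (extChartAt I x).symm y)))
    rwa [(extChartAt I x).right_inv hy] at this
  have hy₀ : y₀ ∈ (extChartAt I x).target := mem_extChartAt_target x
  have h2 := contDiffAt_infty_fderiv (hC y₀ hy₀ s)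
  have h3 : ∀ v : E, HasDerivAt
      (fun s : ℝ => fderiv ℝ (chartFamily I h x) (s, y₀) ((0 : ℝ), v))
      (fderiv ℝ (fderiv ℝ (chartFamily I h x)) (s, y₀) (1, 0) ((0 : ℝ), v)) s := by
    intro v
    have h4 : HasDerivAt (fun s : ℝ => (s, y₀)) ((1 : ℝ), (0 : E)) s :=
      (hasDerivAt_id s).prodMk (hasDerivAt_const s y₀)
    exact (((ContinuousLinearMap.apply ℝ ℝ ((0 : ℝ), v)).hasFDerivAt).comp _
      (h2.differentiableAt (by simp)).hasFDerivAt).comp_hasDerivAt s h4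
  have h5 : (fun s => (mfderiv I 𝓘(ℝ, ℝ) (h s) x v : ℝ)) =
      fun s : ℝ => fderiv ℝ (chartFamily I h x) (s, y₀) ((0 : ℝ), (v : E)) :=
    funext fun s => mfderiv_family_eq hh.contMDiffAt v
  rw [h5]
  refine (h3 v).congr_deriv ?_
  rw [mfderiv_eq_fderiv_chart ((hh.deriv.contMDiff s).mdifferentiable (by simp) x)]
  have h6 : (fun y => _root_.deriv (fun s => h s ((extChartAt I x).symm y)) s) =ᶠ[nhds y₀]
      fun y => fderiv ℝ (chartFamily I h x) (s, y) (1, 0) := by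
    filter_upwards [(isOpen_extChartAt_target x).mem_nhds hy₀] with y hy
    exact (chartFamily_fderiv_fst ((hC y hy s).differentiableAt (by simp))).deriv
  have h7 : HasFDerivAt (fun y : E => fderiv ℝ (chartFamily I h x) (s, y) (1, 0))
      (((fderiv ℝ (fderiv ℝ (chartFamily I h x)) (s, y₀)).comp
        (ContinuousLinearMap.inr ℝ ℝ E)).flip (1, 0)) y₀ :=
    (((ContinuousLinearMap.apply ℝ ℝ ((1 : ℝ), (0 : E))).hasFDerivAt).comp _
      (h2.differentiableAt (by simp)).hasFDerivAt).comp y₀ (hasFDerivAt_prodMk_right s y₀)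
  rw [h6.fderiv_eq, h7.fderiv]
  exact ((hC y₀ hy₀ s).isSymmSndFDerivAt (by simpa using WithTop.coe_le_coe.2 (le_top : (2 : ℕ∞) ≤ ⊤))).eq _ _

theorem mfderiv_chart_apply {f : M → ℝ} (x₀ : M) {x : M} (hx : x ∈ (extChartAt I x₀).source)
    (hf : ContMDiffAt I 𝓘(ℝ, ℝ) ∞ f x) (v : TangentSpace I x) :
    (mfderiv I 𝓘(ℝ, ℝ) f x v : ℝ) =
      fderiv ℝ (fun y => f ((extChartAt I x₀).symm y)) (extChartAt I x₀ x)
        (mfderiv I 𝓘(ℝ, E) (extChartAt I x₀) x v : E) := by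
  set F : E → ℝ := fun y => f ((extChartAt I x₀).symm y)
  have h1 : DifferentiableAt ℝ F (extChartAt I x₀ x) := by
    have hsymm : ContMDiffAt 𝓘(ℝ, E) I ∞ (extChartAt I x₀).symm (extChartAt I x₀ x) :=
      (contMDiffOn_extChartAt_symm x₀).contMDiffAt
        ((isOpen_extChartAt_target x₀).mem_nhds ((extChartAt I x₀).map_source hx))
    rw [← (extChartAt I x₀).left_inv hx] at hf
    exact (hf.comp _ hsymm).contDiffAt.differentiableAt (by simp)
  have h2 : f =ᶠ[nhds x] F ∘ extChartAt I x₀ := by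
    filter_upwards [(isOpen_extChartAt_source x₀).mem_nhds hx] with y hy
    simp [F, -extChartAt, (extChartAt I x₀).left_inv hy]
  have h3 : MDifferentiableAt I 𝓘(ℝ, E) (extChartAt I x₀) x :=
    mdifferentiableAt_extChartAt (by simpa using hx)
  rw [h2.mfderiv_eq]
  have h4 := mfderiv_comp_apply x h1.mdifferentiableAt h3 v
  rw [mfderiv_eq_fderiv] at h4
  exact h4

omit [I.Boundaryless] in
theorem contMDiffAt_mfderiv_extChartAt {X : (m : M) → TangentSpace I m} {x₀ : M}
    (hX : ContMDiffAt I I.tangent ∞ (fun m => (X m : TangentBundle I M)) x₀) :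
    ContMDiffAt I 𝓘(ℝ, E) ∞ (fun x => (mfderiv I 𝓘(ℝ, E) (extChartAt I x₀) x (X x) : E)) x₀ := by
  refine ((Bundle.contMDiffAt_section x₀).1 hX).congr_of_eventuallyEq ?_
  filter_upwards [(chartAt H x₀).open_source.mem_nhds (mem_chart_source H x₀)] with x hx
  rw [← TangentBundle.continuousLinearMapAt_trivializationAt hx]
  exact Bundle.Trivialization.continuousLinearMapAt_apply_of_mem ℝ
    (trivializationAt E (TangentSpace I) x₀) (by simpa using hx) _

theorem SmoothFamily.dirDeriv {h : ℝ → M → ℝ} (hh : SmoothFamily I h)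
    {X : (m : M) → TangentSpace I m}
    (hX : ContMDiff I I.tangent ∞ (fun m => (X m : TangentBundle I M))) :
    SmoothFamily I (fun s => dirDeriv X (h s)) := by
  rintro ⟨s₀, x₀⟩
  have key : ∀ Z : M → E, ContMDiffAt I 𝓘(ℝ, E) ∞ Z x₀ →
      ContMDiffAt (𝓘(ℝ, ℝ).prod I) 𝓘(ℝ, ℝ) ∞ (fun p : ℝ × M =>
        fderiv ℝ (chartFamily I h x₀) (p.1, extChartAt I x₀ p.2) ((0 : ℝ), Z p.2)) (s₀, x₀) := by
    intro Z hZ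
    have h2 := contDiffAt_infty_fderiv
      (contDiffAt_chartFamily (mem_extChartAt_source x₀) (hh.contMDiffAt (x := (s₀, x₀))))
    have h3 : ContMDiffAt (𝓘(ℝ, ℝ).prod I) 𝓘(ℝ, ℝ × E) ∞
        (fun p : ℝ × M => (p.1, extChartAt I x₀ p.2)) (s₀, x₀) :=
      contMDiffAt_fst.prodMk_space
        (ContMDiffAt.comp (s₀, x₀) contMDiffAt_extChartAt contMDiffAt_snd)
    have h4 : ContMDiffAt (𝓘(ℝ, ℝ).prod I) 𝓘(ℝ, E) ∞ (fun p : ℝ × M => Z p.2) (s₀, x₀) :=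
      ContMDiffAt.comp (s₀, x₀) hZ contMDiffAt_snd
    exact (ContMDiffAt.comp (s₀, x₀) h2.contMDiffAt h3).clm_apply
      (contMDiffAt_const.prodMk_space h4)
  refine (key _ (contMDiffAt_mfderiv_extChartAt hX.contMDiffAt)).congr_of_eventuallyEq ?_
  have hev : ∀ᶠ p : ℝ × M in nhds (s₀, x₀), p.2 ∈ (extChartAt I x₀).source :=
    continuous_snd.continuousAt.eventually
      ((isOpen_extChartAt_source x₀).mem_nhds (mem_extChartAt_source x₀))
  filter_upwards [hev] with p hp
  have h5 := (chartFamily_fderiv_snd ((contDiffAt_chartFamily hp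
    (hh.contMDiffAt (x := (p.1, p.2)))).differentiableAt (by simp))).fderiv
  refine (mfderiv_chart_apply x₀ hp (hh.contMDiff p.1).contMDiffAt _).trans ?_
  rw [h5]
  rfl

theorem contMDiff_dirDeriv {g : M → ℝ} (hg : ContMDiff I 𝓘(ℝ, ℝ) ∞ g)
    {X : (m : M) → TangentSpace I m}
    (hX : ContMDiff I I.tangent ∞ (fun m => (X m : TangentBundle I M))) :
    ContMDiff I 𝓘(ℝ, ℝ) ∞ (dirDeriv X g) :=
  ((smoothFamily_const hg).dirDeriv hX).contMDiff 0

end Families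

section Bracket

variable [I.Boundaryless] [IsManifold I ∞ M]

/-- A vector field read in the extended chart at `x₀`. -/
def chartField (X : (m : M) → TangentSpace I m) (x₀ : M) (y : E) : E :=
  VectorField.mpullbackWithin 𝓘(ℝ, E) I (extChartAt I x₀).symm X (Set.range I) y

omit [I.Boundaryless] in
theorem chartField_apply (X : (m : M) → TangentSpace I m) {x₀ : M} {y : E}
    (hy : y ∈ (extChartAt I x₀).target) :
    chartField X x₀ y = (mfderiv I 𝓘(ℝ, E) (extChartAt I x₀) ((extChartAt I x₀).symm y)
      (X ((extChartAt I x₀).symm y)) : E) := by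
  have h1 := mfderiv_extChartAt_comp_mfderivWithin_extChartAt_symm (I := I) hy
  have h2 := isInvertible_mfderivWithin_extChartAt_symm (I := I) hy
  have key : ∀ A B : E →L[ℝ] E, A ∘L B = ContinuousLinearMap.id ℝ E → B.IsInvertible →
      ∀ w, B.inverse w = A w := by
    rintro A _ hAB ⟨e, rfl⟩ w
    rw [ContinuousLinearMap.inverse_equiv]
    simpa using (congrArg (fun L => L (e.symm w)) hAB).symm
  exact key _ _ h1 h2 _

theorem differentiableAt_chartField [CompleteSpace E] {X : (m : M) → TangentSpace I m}
    (hX : ContMDiff I I.tangent ∞ (fun m => (X m : TangentBundle I M))) (x₀ : M) :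
    DifferentiableAt ℝ (chartField X x₀) (extChartAt I x₀ x₀) := by
  have : IsManifold I 2 M := .of_le (n := ∞) (WithTop.coe_le_coe.2 (le_top : (2 : ℕ∞) ≤ ⊤))
  have h1 := ((hX x₀).mdifferentiableAt (by simp)).mdifferentiableWithinAt (s := Set.univ)
  have h2 : DifferentiableWithinAt ℝ (chartField X x₀)
      ((extChartAt I x₀).symm ⁻¹' Set.univ ∩ Set.range I) (extChartAt I x₀ x₀) :=
    h1.differentiableWithinAt_mpullbackWithin_vectorField
  have h3 : (extChartAt I x₀).symm ⁻¹' Set.univ ∩ Set.range I = Set.univ := by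
    simp [I.range_eq_univ]
  rwa [h3, differentiableWithinAt_univ] at h2

theorem dirDeriv_chart {g : M → ℝ} (hg : ContMDiff I 𝓘(ℝ, ℝ) ∞ g)
    (X : (m : M) → TangentSpace I m) {x₀ : M} {y : E} (hy : y ∈ (extChartAt I x₀).target) :
    dirDeriv X g ((extChartAt I x₀).symm y) =
      fderiv ℝ (fun y => g ((extChartAt I x₀).symm y)) y (chartField X x₀ y) := by
  have := mfderiv_chart_apply x₀ ((extChartAt I x₀).map_target hy) hg.contMDiffAt
    (X ((extChartAt I x₀).symm y))
  rw [(extChartAt I x₀).right_inv hy] at this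
  rw [chartField_apply X hy]
  exact this

theorem mfderiv_mlieBracket [CompleteSpace E] {X Y : (m : M) → TangentSpace I m}
    (hX : ContMDiff I I.tangent ∞ (fun m => (X m : TangentBundle I M)))
    (hY : ContMDiff I I.tangent ∞ (fun m => (Y m : TangentBundle I M)))
    {g : M → ℝ} (hg : ContMDiff I 𝓘(ℝ, ℝ) ∞ g) (m : M) :
    (mfderiv I 𝓘(ℝ, ℝ) g m (VectorField.mlieBracket I X Y m) : ℝ) =
      dirDeriv X (dirDeriv Y g) m - dirDeriv Y (dirDeriv X g) m := by
  set y₀ := extChartAt I m m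
  set G : E → ℝ := fun y => g ((extChartAt I m).symm y)
  have hy₀ : y₀ ∈ (extChartAt I m).target := mem_extChartAt_target m
  have hG : ContDiffAt ℝ ∞ G y₀ := by
    have := contDiffAt_chartFamily (h := fun _ => g) (s := 0) (mem_extChartAt_source m)
      ((smoothFamily_const hg).contMDiffAt)
    exact this.comp y₀ (contDiffAt_const.prodMk contDiffAt_id)
  have key : ∀ {X Y : (m : M) → TangentSpace I m},
      ContMDiff I I.tangent ∞ (fun m => (X m : TangentBundle I M)) →
      ContMDiff I I.tangent ∞ (fun m => (Y m : TangentBundle I M)) →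
      dirDeriv X (dirDeriv Y g) m =
        fderiv ℝ (fderiv ℝ G) y₀ (chartField X m y₀) (chartField Y m y₀) +
          fderiv ℝ G y₀ (fderiv ℝ (chartField Y m) y₀ (chartField X m y₀)) := by
    intro X Y hX hY
    have h1 := dirDeriv_chart (contMDiff_dirDeriv hg hY) X hy₀
    rw [extChartAt_to_inv] at h1
    rw [h1]
    have h2 : (fun y => dirDeriv Y g ((extChartAt I m).symm y)) =ᶠ[nhds y₀]
        fun y => fderiv ℝ G y (chartField Y m y) := by
      filter_upwards [(isOpen_extChartAt_target m).mem_nhds hy₀] with y hy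
      exact dirDeriv_chart hg Y hy
    have h3 := ((contDiffAt_infty_fderiv hG).differentiableAt (by simp)).hasFDerivAt.clm_apply
      (differentiableAt_chartField hY m).hasFDerivAt
    rw [h2.fderiv_eq, h3.fderiv]
    simp [add_comm, y₀]
  rw [key hX hY, key hY hX]
  have h4 : (mfderiv I 𝓘(ℝ, ℝ) g m (VectorField.mlieBracket I X Y m) : ℝ) =
      fderiv ℝ G y₀ (fderiv ℝ (chartField Y m) y₀ (chartField X m y₀) -
        fderiv ℝ (chartField X m) y₀ (chartField Y m y₀)) := by
    rw [mfderiv_eq_fderiv_chart (hg.mdifferentiable (by simp) m)]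
    congr 1
    have h5 : ∀ A : E →L[ℝ] E, A = ContinuousLinearMap.id ℝ E → ∀ w, A.inverse w = w := by
      rintro _ rfl w
      rw [ContinuousLinearMap.inverse_id]
      rfl
    have h6 : (extChartAt I m).symm ⁻¹' Set.univ ∩ Set.range I = Set.univ := by
      simp [I.range_eq_univ]
    have h7 : VectorField.lieBracketWithin ℝ (chartField X m) (chartField Y m)
        ((extChartAt I m).symm ⁻¹' Set.univ ∩ Set.range I) y₀ =
        fderiv ℝ (chartField Y m) y₀ (chartField X m y₀) -
          fderiv ℝ (chartField X m) y₀ (chartField Y m y₀) := by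
      rw [h6, VectorField.lieBracketWithin_univ]
      rfl
    exact (h5 _ mfderiv_extChartAt_self _).trans h7
  rw [h4, (hG.isSymmSndFDerivAt (by simpa using WithTop.coe_le_coe.2 (le_top : (2 : ℕ∞) ≤ ⊤))).eq
    (chartField X m y₀), map_sub]
  have h5 : ∀ a b c : ℝ, b - c = (a + b) - (a + c) := fun a b c => by ring
  exact h5 _ _ _

end Bracket

section PowerSeries

open PowerSeries
open Finset.HasAntidiagonal (antidiagonal mem_antidiagonal)

/-- The specialization of a power series in `Y` over `ℝ⟦X⟧` to `Y = X`. -/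
def diagonal : ℝ⟦X⟧⟦X⟧ →+* ℝ⟦X⟧ where
  toFun c := mk fun n => ∑ p ∈ antidiagonal n, coeff p.1 (coeff p.2 c)
  map_one' := by
    ext n
    rw [coeff_mk, coeff_one]
    rcases n with _ | n
    · simp
    · refine (Finset.sum_eq_zero fun p hp => ?_).trans (by simp)
      rw [mem_antidiagonal] at hp
      rw [coeff_one]
      split_ifs with h
      · rw [coeff_one, if_neg (by omega)]
      · simp
  map_zero' := by ext; simp
  map_add' c d := by ext; simp [Finset.sum_add_distrib]
  map_mul' c d := by
    ext n
    simp only [coeff_mk, coeff_mul, map_sum, Finset.sum_mul, Finset.mul_sum, Finset.sum_sigma']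
    refine Finset.sum_nbij'
      (fun q => ⟨(q.2.2.1 + q.2.1.1, q.2.2.2 + q.2.1.2), ⟨(q.2.2.2, q.2.1.2), (q.2.2.1, q.2.1.1)⟩⟩)
      (fun q => ⟨(q.2.2.1 + q.2.1.1, q.2.2.2 + q.2.1.2), ⟨(q.2.2.2, q.2.1.2), (q.2.2.1, q.2.1.1)⟩⟩)
      ?_ ?_ ?_ ?_ ?_
    · rintro ⟨⟨j, k⟩, ⟨a, b⟩, ⟨i, l⟩⟩ h
      simp only [Finset.mem_sigma, mem_antidiagonal] at h ⊢
      obtain ⟨rfl, rfl, rfl⟩ := h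
      exact ⟨by ring, trivial, trivial⟩
    · rintro ⟨⟨j, k⟩, ⟨a, b⟩, ⟨i, l⟩⟩ h
      simp only [Finset.mem_sigma, mem_antidiagonal] at h ⊢
      obtain ⟨rfl, rfl, rfl⟩ := h
      exact ⟨by ring, trivial, trivial⟩
    · rintro ⟨⟨j, k⟩, ⟨a, b⟩, ⟨i, l⟩⟩ h
      simp only [Finset.mem_sigma, mem_antidiagonal] at h ⊢
      obtain ⟨-, rfl, rfl⟩ := h
      rfl
    · rintro ⟨⟨j, k⟩, ⟨a, b⟩, ⟨i, l⟩⟩ h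
      simp only [Finset.mem_sigma, mem_antidiagonal] at h ⊢
      obtain ⟨-, rfl, rfl⟩ := h
      rfl
    · rintro ⟨⟨j, k⟩, ⟨a, b⟩, ⟨i, l⟩⟩ h
      rfl

@[simp]
theorem coeff_diagonal (n : ℕ) (c : ℝ⟦X⟧⟦X⟧) :
    coeff n (diagonal c) = ∑ p ∈ antidiagonal n, coeff p.1 (coeff p.2 c) := by
  simp [diagonal]

@[simp]
theorem diagonal_C (a : ℝ⟦X⟧) : diagonal (C a) = a := by
  ext n
  rw [coeff_diagonal, Finset.sum_eq_single (n, 0)]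
  · simp
  · rintro ⟨i, j⟩ hij hne
    rw [mem_antidiagonal] at hij
    have : j ≠ 0 := by
      rintro rfl
      simp_all
    simp [coeff_C, this]
  · simp

/-- The Taylor series at `0`. -/
def taylor (f : ℝ → ℝ) : ℝ⟦X⟧ := mk fun n => (n ! : ℝ)⁻¹ * iteratedDeriv n f 0

@[simp]
theorem coeff_taylor (n : ℕ) (f : ℝ → ℝ) :
    coeff n (taylor f) = (n ! : ℝ)⁻¹ * iteratedDeriv n f 0 := by
  simp [taylor]

/-- The ring of smooth functions on the line. -/
def smoothRing : Subring (ℝ → ℝ) where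
  carrier := {f | ContDiff ℝ ∞ f}
  mul_mem' {f g} (hf : ContDiff ℝ ∞ f) (hg : ContDiff ℝ ∞ g) := hf.mul hg
  one_mem' := (contDiff_const : ContDiff ℝ ∞ fun _ : ℝ => (1 : ℝ))
  add_mem' {f g} (hf : ContDiff ℝ ∞ f) (hg : ContDiff ℝ ∞ g) := hf.add hg
  zero_mem' := (contDiff_const : ContDiff ℝ ∞ fun _ : ℝ => (0 : ℝ))
  neg_mem' {f} (hf : ContDiff ℝ ∞ f) := hf.neg

theorem contDiffAt_of_smooth {f : ℝ → ℝ} (h : ContDiff ℝ ∞ f) (n : ℕ) (s : ℝ) :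
    ContDiffAt ℝ n f s :=
  h.contDiffAt.of_le (WithTop.coe_le_coe.2 (le_top : (n : ℕ∞) ≤ ⊤))

/-- The Taylor series at `0`, as a ring homomorphism. -/
def taylorHom : smoothRing →+* ℝ⟦X⟧ where
  toFun f := taylor f
  map_one' := by
    ext n
    have : ((1 : smoothRing) : ℝ → ℝ) = fun _ => 1 := rfl
    rw [this, coeff_taylor, iteratedDeriv_const]
    rcases n with _ | n <;> simp [coeff_one]
  map_zero' := by
    ext n
    simp
  map_add' f g := by
    ext n
    simp only [coeff_taylor, map_add, Subring.coe_add]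
    rw [iteratedDeriv_add (contDiffAt_of_smooth f.2 n 0) (contDiffAt_of_smooth g.2 n 0), mul_add]
  map_mul' f g := by
    ext n
    simp only [coeff_taylor, coeff_mul, Subring.coe_mul]
    rw [iteratedDeriv_mul (contDiffAt_of_smooth f.2 n 0) (contDiffAt_of_smooth g.2 n 0),
      Finset.mul_sum, Finset.Nat.sum_antidiagonal_eq_sum_range_succ_mk]
    refine Finset.sum_congr rfl fun i hi => ?_
    have hi : i ≤ n := by simpa [Nat.lt_succ_iff] using hi
    rw [Nat.cast_choose ℝ hi]
    field_simp

theorem taylor_mul {f g : ℝ → ℝ} (hf : ContDiff ℝ ∞ f) (hg : ContDiff ℝ ∞ g) :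
    taylor (fun s => f s * g s) = taylor f * taylor g :=
  map_mul taylorHom ⟨f, hf⟩ ⟨g, hg⟩

theorem taylor_sum {ι : Type*} (t : Finset ι) {f : ι → ℝ → ℝ}
    (hf : ∀ i ∈ t, ContDiff ℝ ∞ (f i)) :
    taylor (fun s => ∑ i ∈ t, f i s) = ∑ i ∈ t, taylor (f i) := by
  ext n
  simp only [coeff_taylor, map_sum]
  rw [iteratedDeriv_fun_sum fun i hi => contDiffAt_of_smooth (hf i hi) n 0, Finset.mul_sum]

theorem taylor_const (c : ℝ) : taylor (fun _ => c) = C c := by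
  ext n
  rcases n with _ | n <;> simp [iteratedDeriv_const, coeff_C]

theorem taylor_congr {f g : ℝ → ℝ} (h : f =ᶠ[nhds 0] g) : taylor f = taylor g := by
  ext n
  simp [h.iteratedDeriv_eq n]

theorem taylor_coeff_zero (f : ℝ → ℝ) : coeff 0 (taylor f) = f 0 := by
  simp

end PowerSeries

section Families

open Finset.HasAntidiagonal (antidiagonal mem_antidiagonal)

/-- The differential of a real function at a point. -/
def dAt (g : M → ℝ) {m : M} (v : TangentSpace I m) : ℝ := mfderiv I 𝓘(ℝ, ℝ) g m v

theorem dirDeriv_eq_dAt (X : (m : M) → TangentSpace I m) (g : M → ℝ) (m : M) :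
    dirDeriv X g m = dAt g (X m) := rfl

variable [I.Boundaryless] [IsManifold I ∞ M]

theorem SmoothFamily.iteratedDeriv {h : ℝ → M → ℝ} (hh : SmoothFamily I h) (k : ℕ) :
    SmoothFamily I (fun s x => iteratedDeriv k (fun s => h s x) s) := by
  induction k generalizing h with
  | zero => simpa using hh
  | succ k ih => simpa only [iteratedDeriv_succ'] using ih hh.deriv

theorem SmoothFamily.dAt_iteratedDeriv {h : ℝ → M → ℝ} (hh : SmoothFamily I h) (k : ℕ) {x : M}
    (v : TangentSpace I x) (s : ℝ) :
    dAt (fun x => _root_.iteratedDeriv k (fun s => h s x) s) v =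
      _root_.iteratedDeriv k (fun s => dAt (h s) v) s := by
  induction k generalizing h with
  | zero => simp
  | succ k ih =>
    simp only [iteratedDeriv_succ']
    rw [ih hh.deriv]
    congr 1
    ext s
    exact (hh.hasDerivAt_mfderiv s x v).deriv.symm

theorem SmoothFamily.contMDiff_taylor {h : ℝ → M → ℝ} (hh : SmoothFamily I h) (k : ℕ) :
    ContMDiff I 𝓘(ℝ, ℝ) ∞ (fun x => PowerSeries.coeff k (taylor fun s => h s x)) := by
  simp only [coeff_taylor]
  exact (contDiff_const.mul contDiff_id :
    ContDiff ℝ ∞ fun r : ℝ => (k ! : ℝ)⁻¹ * r).contMDiff.comp ((hh.iteratedDeriv k).contMDiff 0)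

theorem SmoothFamily.dAt_taylor {h : ℝ → M → ℝ} (hh : SmoothFamily I h) (k : ℕ) {x : M}
    (v : TangentSpace I x) :
    dAt (fun x => PowerSeries.coeff k (taylor fun s => h s x)) v =
      PowerSeries.coeff k (taylor fun s => dAt (h s) v) := by
  simp only [coeff_taylor]
  rw [← hh.dAt_iteratedDeriv]
  have := ((hh.iteratedDeriv k).contMDiff 0).mdifferentiable (by simp) x
  exact congrArg (fun L : E →L[ℝ] ℝ => L v) (const_smul_mfderiv this (k ! : ℝ)⁻¹)

theorem SmoothFamily.swap {h : ℝ → ℝ → ℝ} (hh : SmoothFamily 𝓘(ℝ, ℝ) h) :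
    SmoothFamily 𝓘(ℝ, ℝ) (fun s x => h x s) :=
  ContMDiff.comp hh (contMDiff_snd.prodMk contMDiff_fst)

theorem SmoothFamily.hasDerivAt_diagonal {h : ℝ → ℝ → ℝ} (hh : SmoothFamily 𝓘(ℝ, ℝ) h) (s : ℝ) :
    HasDerivAt (fun s => h s s) (_root_.deriv (fun r => h r s) s + _root_.deriv (h s) s) s := by
  have h1 : ContDiff ℝ ∞ (fun p : ℝ × ℝ => h p.1 p.2) := by
    have h2 := hh
    rw [SmoothFamily, ← modelWithCornersSelf_prod, chartedSpaceSelf_prod] at h2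
    exact h2.contDiff
  have h2 := (h1.differentiable (by simp) (s, s)).hasFDerivAt
  have h3 : HasDerivAt (fun r => h r s) (fderiv ℝ (fun p : ℝ × ℝ => h p.1 p.2) (s, s) (1, 0)) s :=
    h2.comp_hasDerivAt s (f := fun r => (r, s))
      ((hasDerivAt_id s).prodMk (hasDerivAt_const s s))
  have h4 : HasDerivAt (h s) (fderiv ℝ (fun p : ℝ × ℝ => h p.1 p.2) (s, s) (0, 1)) s :=
    h2.comp_hasDerivAt s ((hasDerivAt_const s s).prodMk (hasDerivAt_id s))
  rw [h3.deriv, h4.deriv, ← map_add]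
  have h5 := h2.comp_hasDerivAt s (f := fun r => (r, r))
    ((hasDerivAt_id s).prodMk (hasDerivAt_id s))
  have h6 : ((1, 0) : ℝ × ℝ) + (0, 1) = (1, 1) := by simp
  rw [h6]
  exact h5

theorem taylor_diagonal {h : ℝ → ℝ → ℝ} (hh : SmoothFamily 𝓘(ℝ, ℝ) h) :
    taylor (fun s => h s s) = diagonal (PowerSeries.mk fun k =>
      taylor fun δ => PowerSeries.coeff k (taylor fun s => h s δ)) := by
  ext n
  simp only [coeff_diagonal, PowerSeries.coeff_mk, coeff_taylor]
  induction n generalizing h with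
  | zero => simp
  | succ n ih =>
    have hA := hh.deriv
    have hB := hh.swap.deriv.swap
    have h1 : _root_.deriv (fun s => h s s) = fun s =>
        _root_.deriv (fun r => h r s) s + _root_.deriv (h s) s :=
      funext fun s => (hh.hasDerivAt_diagonal s).deriv
    have h2 : ContDiff ℝ ∞ fun s => _root_.deriv (fun r => h r s) s :=
      (ContMDiff.comp hA (contMDiff_id.prodMk contMDiff_id)).contDiff
    have h3 : ContDiff ℝ ∞ fun s => _root_.deriv (h s) s :=
      (ContMDiff.comp hB (contMDiff_id.prodMk contMDiff_id)).contDiff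
    have hcomm : ∀ k δ, _root_.deriv (fun δ => _root_.iteratedDeriv k (fun s => h s δ) 0) δ =
        _root_.iteratedDeriv k (fun s => _root_.deriv (h s) δ) 0 := by
      intro k δ
      have := hh.dAt_iteratedDeriv k (x := δ) (1 : ℝ) 0
      simp only [dAt, mfderiv_eq_fderiv] at this
      exact this
    set T : ℕ → ℕ → ℝ := fun j k =>
      _root_.iteratedDeriv j (fun δ => _root_.iteratedDeriv k (fun s => h s δ) 0) 0 with hT
    have hTA : ∀ j k, _root_.iteratedDeriv j (fun δ => _root_.iteratedDeriv k
        (fun s => _root_.deriv (fun r => h r δ) s) 0) 0 = T j (k + 1) := by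
      intro j k
      simp only [hT, iteratedDeriv_succ' (n := k)]
    have hTB : ∀ j k, _root_.iteratedDeriv j (fun δ => _root_.iteratedDeriv k
        (fun s => _root_.deriv (h s) δ) 0) 0 = T (j + 1) k := by
      intro j k
      simp only [hT, iteratedDeriv_succ' (n := j)]
      congr 1
      ext δ
      exact (hcomm k δ).symm
    have ihA := ih hA
    have ihB := ih hB
    simp only [iteratedDeriv_const_mul_field] at ihA ihB ⊢
    rw [iteratedDeriv_succ', h1, iteratedDeriv_fun_add (contDiffAt_of_smooth h2 n 0)
      (contDiffAt_of_smooth h3 n 0)]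
    have e1 : ((n + 1)! : ℝ)⁻¹ = ((n : ℝ) + 1)⁻¹ * (n ! : ℝ)⁻¹ := by
      rw [Nat.factorial_succ, ← mul_inv]
      push_cast
      rfl
    rw [e1, mul_assoc, mul_add, ihA, ihB]
    simp only [hTA, hTB]
    rw [inv_mul_eq_iff_eq_mul₀ (by positivity)]
    have e2 : ((n : ℝ) + 1) * ∑ p ∈ antidiagonal (n + 1), (p.1 ! : ℝ)⁻¹ * ((p.2 ! : ℝ)⁻¹ * T p.1 p.2)
        = ∑ p ∈ antidiagonal (n + 1), (p.2 : ℝ) * ((p.1 ! : ℝ)⁻¹ * ((p.2 ! : ℝ)⁻¹ * T p.1 p.2)) +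
          ∑ p ∈ antidiagonal (n + 1),
            (p.1 : ℝ) * ((p.1 ! : ℝ)⁻¹ * ((p.2 ! : ℝ)⁻¹ * T p.1 p.2)) := by
      rw [Finset.mul_sum, ← Finset.sum_add_distrib]
      refine Finset.sum_congr rfl fun p hp => ?_
      rw [mem_antidiagonal] at hp
      have : (p.1 : ℝ) + p.2 = n + 1 := by exact_mod_cast hp
      rw [← this]
      ring
    have e3 : ∀ k : ℕ, ((k + 1 : ℕ) : ℝ) * ((k + 1)! : ℝ)⁻¹ = (k ! : ℝ)⁻¹ := by
      intro k
      rw [Nat.factorial_succ]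
      have : ((k + 1 : ℕ) : ℝ) ≠ 0 := by positivity
      push_cast at this ⊢
      field_simp
    rw [e2, Finset.Nat.sum_antidiagonal_succ', Finset.Nat.sum_antidiagonal_succ]
    simp only [Nat.cast_zero, zero_mul, zero_add]
    congr 1
    · refine Finset.sum_congr rfl fun p _ => ?_
      rw [← e3 p.2]
      ring
    · refine Finset.sum_congr rfl fun p _ => ?_
      rw [← e3 p.1]
      ring

end Families

section Series

open PowerSeries
open Finset.HasAntidiagonal (antidiagonal mem_antidiagonal)

theorem dAt_mul {f g : M → ℝ} (hf : ContMDiff I 𝓘(ℝ, ℝ) ∞ f) (hg : ContMDiff I 𝓘(ℝ, ℝ) ∞ g)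
    {m : M} (v : TangentSpace I m) :
    dAt (fun x => f x * g x) v = dAt f v * g m + f m * dAt g v := by
  have h1 := (hf.mdifferentiable (by simp) m).hasMFDerivAt.mul
    (hg.mdifferentiable (by simp) m).hasMFDerivAt
  have h2 := congrArg (fun L : E →L[ℝ] ℝ => L v) h1.mfderiv
  refine h2.trans ?_
  rw [add_comm, mul_comm (dAt f v)]
  rfl

theorem dAt_add {f g : M → ℝ} (hf : ContMDiff I 𝓘(ℝ, ℝ) ∞ f) (hg : ContMDiff I 𝓘(ℝ, ℝ) ∞ g)
    {m : M} (v : TangentSpace I m) :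
    dAt (fun x => f x + g x) v = dAt f v + dAt g v := by
  have h1 := (hf.mdifferentiable (by simp) m).hasMFDerivAt.add
    (hg.mdifferentiable (by simp) m).hasMFDerivAt
  exact congrArg (fun L : E →L[ℝ] ℝ => L v) h1.mfderiv

theorem dAt_sub {f g : M → ℝ} (hf : ContMDiff I 𝓘(ℝ, ℝ) ∞ f) (hg : ContMDiff I 𝓘(ℝ, ℝ) ∞ g)
    {m : M} (v : TangentSpace I m) :
    dAt (fun x => f x - g x) v = dAt f v - dAt g v := by
  have h1 := (hf.mdifferentiable (by simp) m).hasMFDerivAt.sub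
    (hg.mdifferentiable (by simp) m).hasMFDerivAt
  exact congrArg (fun L : E →L[ℝ] ℝ => L v) h1.mfderiv

theorem contMDiff_finsetSum {ι : Type*} (t : Finset ι) {f : ι → M → ℝ}
    (hf : ∀ i ∈ t, ContMDiff I 𝓘(ℝ, ℝ) ∞ (f i)) :
    ContMDiff I 𝓘(ℝ, ℝ) ∞ (fun x => ∑ i ∈ t, f i x) :=
  ContMDiff.sum hf

theorem dAt_sum {ι : Type*} (t : Finset ι) {f : ι → M → ℝ}
    (hf : ∀ i ∈ t, ContMDiff I 𝓘(ℝ, ℝ) ∞ (f i)) {m : M} (v : TangentSpace I m) :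
    dAt (fun x => ∑ i ∈ t, f i x) v = ∑ i ∈ t, dAt (f i) v := by
  induction t using Finset.cons_induction with
  | empty =>
    simp only [Finset.sum_empty, dAt]
    rw [mfderiv_const]
    rfl
  | cons a t ha ih =>
    simp only [Finset.sum_cons]
    have hf' : ∀ i ∈ t, ContMDiff I 𝓘(ℝ, ℝ) ∞ (f i) :=
      fun i hi => hf i (Finset.mem_cons_of_mem hi)
    rw [dAt_add (hf a (Finset.mem_cons_self a t)) (contMDiff_finsetSum t hf'), ih hf']

variable (I) in
/-- All coefficients of a formal power series of functions are smooth. -/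
def SmoothSeries (a : ℕ → M → ℝ) : Prop := ∀ k, ContMDiff I 𝓘(ℝ, ℝ) ∞ (a k)

/-- The value at a point of a formal power series of functions. -/
def ev (a : ℕ → M → ℝ) (x : M) : ℝ⟦X⟧ := mk fun k => a k x

/-- The differential at a point of a formal power series of functions. -/
def dev (a : ℕ → M → ℝ) {x : M} (v : TangentSpace I x) : ℝ⟦X⟧ := mk fun k => dAt (a k) v

omit [TopologicalSpace M] in
@[simp]
theorem coeff_ev (k : ℕ) (a : ℕ → M → ℝ) (x : M) : coeff k (ev a x) = a k x := by simp [ev]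

@[simp]
theorem coeff_dev (k : ℕ) (a : ℕ → M → ℝ) {x : M} (v : TangentSpace I x) :
    coeff k (dev a v) = dAt (a k) v := by simp [dev]

/-- The formal tensor `f dg ⊗ dh`. -/
def tri (f g h : ℕ → M → ℝ) {x : M} (v w : TangentSpace I x) : ℝ⟦X⟧ :=
  ev f x * dev g v * dev h w

/-- The Leibniz expression `f' dg ⊗ dh + f dg' ⊗ dh + f dg ⊗ dh'`. -/
def leib (f g h f' g' h' : ℕ → M → ℝ) {x : M} (v w : TangentSpace I x) : ℝ⟦X⟧ :=
  tri f' g h v w + tri f g' h v w + tri f g h' v w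

/-- A vector field acting coefficientwise on a formal power series of functions. -/
def act (X : (m : M) → TangentSpace I m) (a : ℕ → M → ℝ) (k : ℕ) : M → ℝ := dirDeriv X (a k)

/-- A formal vector field acting on a formal power series of functions. -/
def formalAct (R : ℕ → (m : M) → TangentSpace I m) (a : ℕ → M → ℝ) (n : ℕ) (x : M) : ℝ :=
  ∑ p ∈ antidiagonal n, dirDeriv (R p.1) (a p.2) x

theorem contMDiff_coeff_mul {A B : M → ℝ⟦X⟧}
    (hA : ∀ k, ContMDiff I 𝓘(ℝ, ℝ) ∞ fun x => coeff k (A x))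
    (hB : ∀ k, ContMDiff I 𝓘(ℝ, ℝ) ∞ fun x => coeff k (B x)) (k : ℕ) :
    ContMDiff I 𝓘(ℝ, ℝ) ∞ fun x => coeff k (A x * B x) := by
  simp only [coeff_mul]
  exact contMDiff_finsetSum _ fun p _ => (hA p.1).mul (hB p.2)

theorem dAt_coeff_mul {A B : M → ℝ⟦X⟧}
    (hA : ∀ k, ContMDiff I 𝓘(ℝ, ℝ) ∞ fun x => coeff k (A x))
    (hB : ∀ k, ContMDiff I 𝓘(ℝ, ℝ) ∞ fun x => coeff k (B x)) (k : ℕ) {m : M}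
    (v : TangentSpace I m) :
    dAt (fun x => coeff k (A x * B x)) v =
      coeff k (mk (fun j => dAt (fun x => coeff j (A x)) v) * B m +
        A m * mk (fun j => dAt (fun x => coeff j (B x)) v)) := by
  simp only [map_add, coeff_mul, coeff_mk]
  rw [dAt_sum _ fun p _ => (hA p.1).mul (hB p.2), ← Finset.sum_add_distrib]
  exact Finset.sum_congr rfl fun p _ => dAt_mul (hA p.1) (hB p.2) v

variable [I.Boundaryless] [IsManifold I ∞ M]

theorem SmoothSeries.act {a : ℕ → M → ℝ} (ha : SmoothSeries I a)
    {X : (m : M) → TangentSpace I m}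
    (hX : ContMDiff I I.tangent ∞ (fun m => (X m : TangentBundle I M))) :
    SmoothSeries I (act X a) :=
  fun k => contMDiff_dirDeriv (ha k) hX

theorem SmoothSeries.formalAct {a : ℕ → M → ℝ} (ha : SmoothSeries I a)
    {R : ℕ → (m : M) → TangentSpace I m}
    (hR : ∀ k, ContMDiff I I.tangent ∞ (fun m => (R k m : TangentBundle I M))) :
    SmoothSeries I (formalAct R a) :=
  fun _ => contMDiff_finsetSum _ fun p _ => contMDiff_dirDeriv (ha p.2) (hR p.1)

theorem dev_formalAct {a : ℕ → M → ℝ} (ha : SmoothSeries I a)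
    {R : ℕ → (m : M) → TangentSpace I m}
    (hR : ∀ k, ContMDiff I I.tangent ∞ (fun m => (R k m : TangentBundle I M)))
    {x : M} (v : TangentSpace I x) :
    dev (formalAct R a) v = diagonal (mk fun k => dev (act (R k) a) v) := by
  ext n
  simp only [coeff_dev, coeff_diagonal, coeff_mk]
  rw [← Finset.Nat.sum_antidiagonal_swap]
  exact dAt_sum _ (fun p _ => contMDiff_dirDeriv (ha p.2) (hR p.1)) v

omit [I.Boundaryless] [IsManifold I ∞ M] in
theorem ev_formalAct (a : ℕ → M → ℝ) (R : ℕ → (m : M) → TangentSpace I m) (x : M) :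
    ev (formalAct R a) x = diagonal (mk fun k => ev (act (R k) a) x) := by
  ext n
  simp only [coeff_ev, coeff_diagonal, coeff_mk]
  rw [← Finset.Nat.sum_antidiagonal_swap]
  rfl

theorem leib_formalAct {f g h : ℕ → M → ℝ} (hg : SmoothSeries I g)
    (hh : SmoothSeries I h) {R : ℕ → (m : M) → TangentSpace I m}
    (hR : ∀ k, ContMDiff I I.tangent ∞ (fun m => (R k m : TangentBundle I M)))
    {x : M} (v w : TangentSpace I x) :
    leib f g h (formalAct R f) (formalAct R g) (formalAct R h) v w =
      diagonal (mk fun k => leib f g h (act (R k) f) (act (R k) g) (act (R k) h) v w) := by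
  simp only [leib, tri]
  rw [ev_formalAct, dev_formalAct hg hR, dev_formalAct hh hR, ← diagonal_C (ev f x),
    ← diagonal_C (dev g v), ← diagonal_C (dev h w)]
  simp only [← map_mul diagonal, ← map_add]
  congr 1
  ext1 k
  have h1 : C (ev f x) * C (dev g v) = C (ev f x * dev g v) := (map_mul _ _ _).symm
  simp [coeff_mul_C, coeff_C_mul]
  rw [h1, coeff_C_mul, coeff_mk]

theorem coeff_leib_formalAct {f g h : ℕ → M → ℝ} (hg : SmoothSeries I g)
    (hh : SmoothSeries I h) {R : ℕ → (m : M) → TangentSpace I m}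
    (hR : ∀ k, ContMDiff I I.tangent ∞ (fun m => (R k m : TangentBundle I M)))
    {x : M} (v w : TangentSpace I x) (n : ℕ) :
    coeff n (leib f g h (formalAct R f) (formalAct R g) (formalAct R h) v w) =
      ∑ p ∈ antidiagonal n,
        coeff p.2 (leib f g h (act (R p.1) f) (act (R p.1) g) (act (R p.1) h) v w) := by
  rw [leib_formalAct hg hh hR, coeff_diagonal, ← Finset.Nat.sum_antidiagonal_swap]
  simp

theorem lieDeriv_tri [CompleteSpace E] {f g h : ℕ → M → ℝ} (hf : SmoothSeries I f)
    (hg : SmoothSeries I g) (hh : SmoothSeries I h) {X : (m : M) → TangentSpace I m}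
    (hX : ContMDiff I I.tangent ∞ (fun m => (X m : TangentBundle I M)))
    (Y Z : SmoothVectorField I M) (m : M) (k : ℕ) :
    dirDeriv X (fun x => coeff k (tri f g h (Y x) (Z x))) m -
      coeff k (tri f g h (VectorField.mlieBracket I X Y m) (Z m)) -
      coeff k (tri f g h (Y m) (VectorField.mlieBracket I X Z m)) =
      coeff k (leib f g h (act X f) (act X g) (act X h) (Y m) (Z m)) := by
  have hgY : ∀ k, ContMDiff I 𝓘(ℝ, ℝ) ∞ fun x => coeff k (dev g (Y x)) := fun k => by
    simpa using! contMDiff_dirDeriv (hg k) Y.contMDiff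
  have hhZ : ∀ k, ContMDiff I 𝓘(ℝ, ℝ) ∞ fun x => coeff k (dev h (Z x)) := fun k => by
    simpa using! contMDiff_dirDeriv (hh k) Z.contMDiff
  have hf' : ∀ k, ContMDiff I 𝓘(ℝ, ℝ) ∞ fun x => coeff k (ev f x) := fun k => by
    simpa using hf k
  have h1 : dirDeriv X (fun x => coeff k (tri f g h (Y x) (Z x))) m =
      coeff k ((ev (act X f) m * dev g (Y m) + ev f m *
        mk (fun j => dirDeriv X (dirDeriv Y (g j)) m)) * dev h (Z m) +
        ev f m * dev g (Y m) * mk (fun j => dirDeriv X (dirDeriv Z (h j)) m)) := by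
    rw [dirDeriv_eq_dAt]
    simp only [tri]
    rw [dAt_coeff_mul (contMDiff_coeff_mul hf' hgY) hhZ]
    have h2 : (mk fun j => dAt (fun x => coeff j (ev f x * dev g (Y x))) (X m)) =
        ev (act X f) m * dev g (Y m) + ev f m * mk (fun j => dirDeriv X (dirDeriv Y (g j)) m) := by
      ext j
      rw [coeff_mk, dAt_coeff_mul hf' hgY]
      simp only [coeff_ev, coeff_dev]
      rfl
    rw [h2]
    simp only [coeff_dev]
    rfl
  have h2 : ∀ {g : ℕ → M → ℝ}, SmoothSeries I g → ∀ Y : SmoothVectorField I M,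
      dev g (VectorField.mlieBracket I X Y m) =
      mk (fun j => dirDeriv X (dirDeriv Y (g j)) m) - dev (act X g) (Y m) := by
    intro g hg Y
    ext j
    simp only [coeff_dev, map_sub, coeff_mk]
    exact mfderiv_mlieBracket hX Y.contMDiff (hg j) m
  rw [h1]
  simp only [tri, leib]
  rw [h2 hg Y, h2 hh Z, ← map_sub, ← map_sub]
  congr 1
  ring

theorem lieDeriv_eq_leib [CompleteSpace E] {ι : Type*} [Fintype ι] {f g h : ι → ℕ → M → ℝ}
    (hf : ∀ i, SmoothSeries I (f i)) (hg : ∀ i, SmoothSeries I (g i))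
    (hh : ∀ i, SmoothSeries I (h i)) {X : (m : M) → TangentSpace I m}
    (hX : ContMDiff I I.tangent ∞ (fun m => (X m : TangentBundle I M)))
    {τ : TwoTensor I M} {m : M} {k : ℕ}
    (hτ : ∀ᶠ x in nhds m, ∀ v w : TangentSpace I x,
      τ x v w = ∑ i, coeff k (tri (f i) (g i) (h i) v w))
    (Y Z : SmoothVectorField I M) :
    lieDeriv X τ Y Z m = ∑ i, coeff k
      (leib (f i) (g i) (h i) (act X (f i)) (act X (g i)) (act X (h i)) (Y m) (Z m)) := by
  have h1 : dirDeriv X (fun x => τ x (Y x) (Z x)) m =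
      ∑ i, dirDeriv X (fun x => coeff k (tri (f i) (g i) (h i) (Y x) (Z x))) m := by
    have h2 : (fun x => τ x (Y x) (Z x)) =ᶠ[nhds m]
        fun x => ∑ i, coeff k (tri (f i) (g i) (h i) (Y x) (Z x)) := by
      filter_upwards [hτ] with x hx using hx _ _
    simp only [dirDeriv_eq_dAt]
    rw [dAt, h2.mfderiv_eq]
    refine dAt_sum _ (fun i _ => ?_) (X m)
    refine contMDiff_coeff_mul (contMDiff_coeff_mul (fun k => ?_) fun k => ?_) (fun k => ?_) k
    · simpa using hf i k
    · simpa using! contMDiff_dirDeriv (hg i k) Y.contMDiff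
    · simpa using! contMDiff_dirDeriv (hh i k) Z.contMDiff
  rw [lieDeriv, h1, hτ.self_of_nhds, hτ.self_of_nhds, ← Finset.sum_sub_distrib,
    ← Finset.sum_sub_distrib]
  exact Finset.sum_congr rfl fun i _ => lieDeriv_tri (hf i) (hg i) (hh i) hX Y Z m k

end Series

section Frames

variable [IsManifold I ∞ M]

variable (I) in
/-- Functions `g i` and vector fields `Y i` with `∑ dg i ⊗ Y i = id` near every point of `K`. -/
structure GlobalFrame (K : Set M) where
  ι : Type
  fintype : Fintype ι
  field : ι → (m : M) → TangentSpace I m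
  field_smooth : ∀ i, ContMDiff I I.tangent ∞ (fun m => (field i m : TangentBundle I M))
  coord : ι → M → ℝ
  coord_smooth : ∀ i, ContMDiff I 𝓘(ℝ, ℝ) ∞ (coord i)
  cutoff : M → ℝ
  cutoff_smooth : ContMDiff I 𝓘(ℝ, ℝ) ∞ cutoff
  sum_eq : ∀ (m : M) (v : TangentSpace I m), ∑ i, dAt (coord i) v • field i m = cutoff m • v
  cutoff_eq_one : ∀ m ∈ K, cutoff =ᶠ[nhds m] 1

attribute [instance] GlobalFrame.fintype

theorem nonempty_globalFrame_empty : Nonempty (GlobalFrame I (∅ : Set M)) :=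
  ⟨{ ι := Empty
     fintype := inferInstance
     field := fun i => i.elim
     field_smooth := fun i => i.elim
     coord := fun i => i.elim
     coord_smooth := fun i => i.elim
     cutoff := fun _ => 0
     cutoff_smooth := contMDiff_const
     sum_eq := fun m v => by simp
     cutoff_eq_one := fun m hm => hm.elim }⟩

theorem GlobalFrame.union {K L : Set M} (A : GlobalFrame I K) (B : GlobalFrame I L) :
    Nonempty (GlobalFrame I (K ∪ L)) := by
  have hs : ContMDiff I 𝓘(ℝ, ℝ) ∞ (fun m => 1 - A.cutoff m) := contMDiff_const.sub A.cutoff_smooth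
  exact ⟨{
    ι := A.ι ⊕ B.ι
    fintype := inferInstance
    field := Sum.elim A.field fun i m => (1 - A.cutoff m) • B.field i m
    field_smooth := by
      rintro (i | i)
      · exact A.field_smooth i
      · exact hs.smul_section (B.field_smooth i)
    coord := Sum.elim A.coord B.coord
    coord_smooth := by
      rintro (i | i)
      · exact A.coord_smooth i
      · exact B.coord_smooth i
    cutoff := fun m => A.cutoff m + (1 - A.cutoff m) * B.cutoff m
    cutoff_smooth := A.cutoff_smooth.add (hs.mul B.cutoff_smooth)
    sum_eq := fun m v => by
      rw [Fintype.sum_sum_type]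
      simp only [Sum.elim_inl, Sum.elim_inr, A.sum_eq, add_smul, mul_smul]
      rw [← B.sum_eq, Finset.smul_sum]
      simp only [smul_comm (1 - A.cutoff m)]
    cutoff_eq_one := by
      rintro m (hm | hm)
      · filter_upwards [A.cutoff_eq_one m hm] with x hx
        simp [hx]
      · filter_upwards [B.cutoff_eq_one m hm] with x hx
        simp [hx] }⟩

/-- A frame near a larger set is a frame near a smaller set. -/
def GlobalFrame.mono {K L : Set M} (h : K ⊆ L) (A : GlobalFrame I L) : GlobalFrame I K :=
  { A with cutoff_eq_one := fun m hm => A.cutoff_eq_one m (h hm) }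

variable [FiniteDimensional ℝ E] [T2Space M]

theorem exists_globalFrame_nhds (p : M) : ∃ t ∈ nhds p, Nonempty (GlobalFrame I t) := by
  obtain ⟨χ⟩ : Nonempty (SmoothBumpFunction I p) := inferInstance
  obtain ⟨ρ, -, hρ⟩ := (SmoothBumpFunction.nhds_basis_tsupport (I := I) p).mem_iff.1
    (interior_mem_nhds.2 χ.eventuallyEq_one)
  let b := Module.finBasis ℝ E
  let e := trivializationAt E (TangentSpace I : M → Type _) p
  have he : e.baseSet = (chartAt H p).source := rfl
  have hone : ρ =ᶠ[nhds p] 1 := ρ.eventuallyEq_one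
  obtain ⟨t, ht, hto, hpt⟩ := eventually_nhds_iff.1 hone
  refine ⟨t, hto.mem_nhds hpt, ⟨{
    ι := Fin (Module.finrank ℝ E)
    fintype := inferInstance
    field := fun i => (ρ : M → ℝ) • e.localFrame b i
    field_smooth := fun i => ContMDiffOn.smul_section_of_tsupport (u := e.baseSet)
      ρ.contMDiff.contMDiffOn e.open_baseSet (he ▸ ρ.tsupport_subset_chartAt_source)
      (e.contMDiffOn_localFrame_baseSet ∞ b i)
    coord := fun i m => χ m • (LinearMap.toContinuousLinearMap (b.coord i)) (extChartAt I p m)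
    coord_smooth := fun i => χ.contMDiff_smul
      ((ContinuousLinearMap.contMDiff _).comp_contMDiffOn contMDiffOn_extChartAt)
    cutoff := ρ
    cutoff_smooth := ρ.contMDiff
    sum_eq := fun m v => ?_
    cutoff_eq_one := fun m hm => Filter.eventually_of_mem (hto.mem_nhds hm) ht }⟩⟩
  by_cases hm : m ∈ tsupport ρ
  · have hms : m ∈ (chartAt H p).source := ρ.tsupport_subset_chartAt_source hm
    have hmi : (fun x => χ x) =ᶠ[nhds m] 1 := by
      have h0 : {x | χ x = (1 : M → ℝ) x} ∈ nhds m :=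
        Filter.mem_of_superset (isOpen_interior.mem_nhds (hρ hm)) interior_subset
      exact h0
    have h1 : ∀ i, dAt (fun m => χ m • (LinearMap.toContinuousLinearMap (b.coord i))
        (extChartAt I p m)) v = b.coord i (mfderiv I 𝓘(ℝ, E) (extChartAt I p) m v) := by
      intro i
      have h2 : (fun m => χ m • (LinearMap.toContinuousLinearMap (b.coord i))
          (extChartAt I p m)) =ᶠ[nhds m]
          (LinearMap.toContinuousLinearMap (b.coord i)) ∘ (extChartAt I p) := by
        filter_upwards [hmi] with x hx
        have hx' : χ x = 1 := hx
        simp [hx']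
      rw [dAt, h2.mfderiv_eq]
      have h3 := mfderiv_comp_apply m
        (LinearMap.toContinuousLinearMap (b.coord i)).mdifferentiableAt
        (mdifferentiableAt_extChartAt (I := I) hms) v
      rw [ContinuousLinearMap.mfderiv_eq] at h3
      exact h3
    have h4 : ∀ i, e.localFrame b i m = e.symmL ℝ m (b i) := by
      intro i
      rw [e.localFrame_apply_of_mem_baseSet b (he ▸ hms)]
      have hb : m ∈ e.baseSet := he ▸ hms
      refine Eq.trans ?_ (e.symmL_apply (R := ℝ) hb _).symm
      simp [Bundle.Trivialization.basisAt]
    have h5 : e.symmL ℝ m (mfderiv I 𝓘(ℝ, E) (extChartAt I p) m v) = v := by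
      have h6 := TangentBundle.continuousLinearMapAt_trivializationAt (𝕜 := ℝ) (I := I) hms
      rw [← h6]
      exact e.symmL_continuousLinearMapAt (R := ℝ) hms v
    have h7 : ∑ i, b.coord i (mfderiv I 𝓘(ℝ, E) (extChartAt I p) m v) • e.symmL ℝ m (b i) = v := by
      simp only [← map_smul, ← map_sum]
      refine Eq.trans ?_ h5
      congr 1
      exact b.sum_repr _
    refine Eq.trans ?_ (congrArg (fun u => ρ m • u) h7)
    rw [Finset.smul_sum]
    refine Finset.sum_congr rfl fun i _ => ?_
    rw [h1, ← h4]
    exact smul_comm _ _ _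
  · have : ρ m = 0 := image_eq_zero_of_notMem_tsupport hm
    simp [this]

theorem nonempty_globalFrame {K : Set M} (hK : IsCompact K) : Nonempty (GlobalFrame I K) := by
  refine hK.induction_on nonempty_globalFrame_empty (fun s t hst ⟨A⟩ => ⟨A.mono hst⟩)
    (fun s t ⟨A⟩ ⟨B⟩ => A.union B) fun x _ => ?_
  obtain ⟨t, ht, h⟩ := exists_globalFrame_nhds (I := I) x
  exact ⟨t, mem_nhdsWithin_of_mem_nhds ht, h⟩

theorem exists_smoothVectorField (m : M) (v : TangentSpace I m) :
    ∃ Y : SmoothVectorField I M, Y m = v := by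
  obtain ⟨A⟩ := nonempty_globalFrame (I := I) (isCompact_singleton (x := m))
  let c : A.ι → ℝ := fun i => dAt (A.coord i) v
  let Y : A.ι → SmoothVectorField I M := fun i => ⟨A.field i, A.field_smooth i⟩
  refine ⟨∑ i, c i • Y i, ?_⟩
  have h1 : (∑ i, c i • Y i) m = ∑ i, c i • A.field i m := by
    rw [← ContMDiffSection.coeAddHom_apply, map_sum, Finset.sum_apply]
    rfl
  rw [h1, A.sum_eq, (A.cutoff_eq_one m rfl).self_of_nhds]
  simp

end Frames

section Representation

open PowerSeries

/-- A function as a constant formal power series. -/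
def constSeries (g : M → ℝ) : ℕ → M → ℝ
  | 0 => g
  | _ + 1 => fun _ => 0

/-- The Taylor coefficients at `0` of a family of functions. -/
def taylorSeries (f : ℝ → M → ℝ) (k : ℕ) (x : M) : ℝ := coeff k (taylor fun s => f s x)

theorem smoothSeries_const {g : M → ℝ} (hg : ContMDiff I 𝓘(ℝ, ℝ) ∞ g) :
    SmoothSeries I (constSeries g)
  | 0 => hg
  | _ + 1 => contMDiff_const

theorem dev_constSeries (g : M → ℝ) {x : M} (v : TangentSpace I x) :
    dev (constSeries g) v = C (dAt g v) := by
  ext k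
  rcases k with _ | k
  · simp [constSeries]
  · rw [coeff_dev, coeff_C, if_neg (Nat.succ_ne_zero k), dAt]
    exact congrArg (fun L : E →L[ℝ] ℝ => L v) (mfderiv_const (I := I) (I' := 𝓘(ℝ, ℝ)) (c := (0 : ℝ)))

omit [TopologicalSpace M] in
theorem ev_taylorSeries (f : ℝ → M → ℝ) (x : M) :
    ev (taylorSeries f) x = taylor fun s => f s x := by
  ext k
  rw [coeff_ev, taylorSeries]

variable [IsManifold I ∞ M]

theorem SmoothFamily.taylorSeries [I.Boundaryless] {f : ℝ → M → ℝ} (hf : SmoothFamily I f) :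
    SmoothSeries I (taylorSeries f) :=
  fun k => hf.contMDiff_taylor k

/-- An expression of `Ω_{sγ}` as a finite sum of terms `f dg ⊗ dh` on a neighborhood of `K`. -/
structure Representation (Ω : PresymplecticForm I M Γ) (γ : Γ) (K : Set M) where
  ι : Type
  fintype : Fintype ι
  coef : ι → ℝ → M → ℝ
  coef_smooth : ∀ i, SmoothFamily I (coef i)
  left : ι → M → ℝ
  left_smooth : ∀ i, ContMDiff I 𝓘(ℝ, ℝ) ∞ (left i)
  right : ι → M → ℝ
  right_smooth : ∀ i, ContMDiff I 𝓘(ℝ, ℝ) ∞ (right i)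
  domain : Set M
  isOpen_domain : IsOpen domain
  subset_domain : K ⊆ domain
  form_eq : ∀ x ∈ domain, ∀ (s : ℝ) (v w : TangentSpace I x),
    Ω.form (s • γ) x v w = ∑ i, coef i s x * dAt (left i) v * dAt (right i) w

attribute [instance] Representation.fintype

theorem nonempty_representation [I.Boundaryless] [FiniteDimensional ℝ E] [T2Space M]
    (Ω : PresymplecticForm I M Γ) (γ : Γ) {K : Set M} (hK : IsCompact K) :
    Nonempty (Representation Ω γ K) := by
  obtain ⟨A⟩ := nonempty_globalFrame (I := I) hK
  refine ⟨{
    ι := A.ι × A.ι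
    fintype := inferInstance
    coef := fun i s x => Ω.form (s • γ) x (A.field i.1 x) (A.field i.2 x)
    coef_smooth := fun i => ?_
    left := fun i => A.coord i.1
    left_smooth := fun i => A.coord_smooth i.1
    right := fun i => A.coord i.2
    right_smooth := fun i => A.coord_smooth i.2
    domain := interior {x | A.cutoff x = 1}
    isOpen_domain := isOpen_interior
    subset_domain := fun x hx => mem_interior_iff_mem_nhds.2 (A.cutoff_eq_one x hx)
    form_eq := fun x hx s v w => ?_ }⟩
  · have h1 : ContMDiff (𝓘(ℝ, ℝ).prod I) (I.prod 𝓘(ℝ, Γ)) ∞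
        (fun p : ℝ × M => (p.2, p.1 • γ)) :=
      contMDiff_snd.prodMk ((contDiff_id.smul contDiff_const :
        ContDiff ℝ ∞ fun s : ℝ => s • γ).contMDiff.comp contMDiff_fst)
    have h2 := Ω.smooth.comp h1
    intro p
    have h3 := ContMDiffAt.clm_bundle_apply₂ (IB := I) (IM := 𝓘(ℝ, ℝ).prod I) (n := ∞)
      (E₁ := fun x : M => TangentSpace I x) (E₂ := fun x : M => TangentSpace I x)
      (E₃ := fun _ : M => ℝ) (F₁ := E) (F₂ := E) (F₃ := ℝ)
      (b := fun p : ℝ × M => p.2) (ψ := fun p => Ω.form (p.1 • γ) p.2)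
      (v := fun p => A.field i.1 p.2) (w := fun p => A.field i.2 p.2) (x := p)
      (h2 p) (((A.field_smooth i.1).comp contMDiff_snd) p)
      (((A.field_smooth i.2).comp contMDiff_snd) p)
    exact (Bundle.contMDiffAt_totalSpace.1 h3).2
  · have hx1 : A.cutoff x = 1 := (interior_subset hx : x ∈ {x | A.cutoff x = 1})
    have hv : ∀ v : TangentSpace I x, v = ∑ i, dAt (A.coord i) v • A.field i x := fun v => by
      rw [A.sum_eq, hx1, one_smul]
    conv_lhs => rw [hv v, hv w]
    rw [Fintype.sum_prod_type]
    simp only [map_sum, map_smul, sum_apply, smul_apply,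
      Finset.mul_sum, smul_eq_mul]
    rw [Finset.sum_comm]
    refine Finset.sum_congr rfl fun i _ => Finset.sum_congr rfl fun j _ => ?_
    ring

theorem iteratedDeriv_sum_smul {ι V : Type*} [Fintype ι] [NormedAddCommGroup V] [NormedSpace ℝ V]
    {c : ι → ℝ → ℝ} (hc : ∀ i, ContDiff ℝ ∞ (c i)) (L : ι → V) (k : ℕ) :
    iteratedDeriv k (fun s => ∑ i, c i s • L i) 0 = ∑ i, iteratedDeriv k (c i) 0 • L i := by
  rw [iteratedDeriv_fun_sum (f := fun i s => c i s • L i)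
      fun i _ => (contDiffAt_of_smooth (hc i) k 0).smul contDiffAt_const]
  exact Finset.sum_congr rfl fun i _ => iteratedDeriv_smul_const (contDiffAt_of_smooth (hc i) k 0) _

theorem iteratedDeriv_sum_mul_mul {ι : Type*} [Fintype ι] {c : ι → ℝ → ℝ}
    (hc : ∀ i, ContDiff ℝ ∞ (c i)) {a b : ι → E →L[ℝ] ℝ} {σ : ℝ → E →L[ℝ] E →L[ℝ] ℝ}
    (hσ : ∀ s v w, σ s v w = ∑ i, c i s * a i v * b i w) (k : ℕ) (v w : E) :
    ((k ! : ℝ)⁻¹ • iteratedDeriv k σ 0) v w =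
      ∑ i, (k ! : ℝ)⁻¹ * iteratedDeriv k (c i) 0 * a i v * b i w := by
  have h1 : σ = fun s => ∑ i, c i s • (a i).smulRight (b i) := by
    ext s v w
    simp [hσ, mul_assoc]
  rw [h1, iteratedDeriv_sum_smul hc]
  simp [Finset.mul_sum, mul_assoc]

namespace Representation

variable {Ω : PresymplecticForm I M Γ} {γ : Γ} {K : Set M} (A : Representation Ω γ K)

/-- The Taylor series of the coefficients. -/
def f (i : A.ι) : ℕ → M → ℝ := taylorSeries (A.coef i)

/-- The left functions as constant series. -/
def g (i : A.ι) : ℕ → M → ℝ := constSeries (A.left i)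

/-- The right functions as constant series. -/
def h (i : A.ι) : ℕ → M → ℝ := constSeries (A.right i)

theorem smooth_f [I.Boundaryless] (i : A.ι) : SmoothSeries I (A.f i) := (A.coef_smooth i).taylorSeries

theorem smooth_g (i : A.ι) : SmoothSeries I (A.g i) := smoothSeries_const (A.left_smooth i)

theorem smooth_h (i : A.ι) : SmoothSeries I (A.h i) := smoothSeries_const (A.right_smooth i)

theorem term_eq {x : M} (hx : x ∈ A.domain) (k : ℕ) (v w : TangentSpace I x) :
    Ω.term k γ x v w = ∑ i, coeff k (tri (A.f i) (A.g i) (A.h i) v w) := by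
  have h1 := iteratedDeriv_sum_mul_mul (E := E) (fun i => (A.coef_smooth i).contDiff x)
    (a := fun i => mfderiv I 𝓘(ℝ, ℝ) (A.left i) x) (b := fun i => mfderiv I 𝓘(ℝ, ℝ) (A.right i) x)
    (A.form_eq x hx) k v w
  refine h1.trans ?_
  simp only [tri, f, g, h, ev_taylorSeries, dev_constSeries, coeff_mul_C, coeff_taylor]
  rfl

end Representation

end Representation

section Curves

open PowerSeries
open Finset.HasAntidiagonal (antidiagonal mem_antidiagonal)

/-- A curve of formal power series with smooth coefficients. -/
def SmoothCurve (A : ℝ → ℝ⟦X⟧) : Prop := ∀ k, ContDiff ℝ ∞ fun s => coeff k (A s)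

/-- The Taylor series at `s = 0` of a curve `s ↦ A s` of formal power series in the same
variable `s`. -/
def taylorCurve (A : ℝ → ℝ⟦X⟧) : ℝ⟦X⟧ := diagonal (mk fun k => taylor fun s => coeff k (A s))

theorem coeff_taylorCurve (A : ℝ → ℝ⟦X⟧) (n : ℕ) : coeff n (taylorCurve A) =
    ∑ p ∈ antidiagonal n, coeff p.1 (taylor fun s => coeff p.2 (A s)) := by
  rw [taylorCurve, coeff_diagonal]
  simp only [coeff_mk]

theorem SmoothCurve.mul {A B : ℝ → ℝ⟦X⟧} (hA : SmoothCurve A) (hB : SmoothCurve B) :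
    SmoothCurve fun s => A s * B s := by
  intro k
  simp only [coeff_mul]
  exact ContDiff.sum fun p _ => (hA p.1).mul (hB p.2)

theorem SmoothCurve.add {A B : ℝ → ℝ⟦X⟧} (hA : SmoothCurve A) (hB : SmoothCurve B) :
    SmoothCurve fun s => A s + B s := by
  intro k
  simp only [map_add]
  exact (hA k).add (hB k)

theorem SmoothCurve.sum {ι : Type*} (t : Finset ι) {A : ι → ℝ → ℝ⟦X⟧}
    (hA : ∀ i ∈ t, SmoothCurve (A i)) : SmoothCurve fun s => ∑ i ∈ t, A i s := by
  intro k
  simp only [map_sum]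
  exact ContDiff.sum fun i hi => hA i hi k

theorem taylorCurve_mul {A B : ℝ → ℝ⟦X⟧} (hA : SmoothCurve A) (hB : SmoothCurve B) :
    taylorCurve (fun s => A s * B s) = taylorCurve A * taylorCurve B := by
  rw [taylorCurve, taylorCurve, taylorCurve, ← map_mul]
  congr 1
  ext1 k
  simp only [coeff_mk, coeff_mul]
  rw [taylor_sum _ fun p _ => (hA p.1).mul (hB p.2)]
  exact Finset.sum_congr rfl fun p _ => taylor_mul (hA p.1) (hB p.2)

theorem taylorCurve_sum {ι : Type*} (t : Finset ι) {A : ι → ℝ → ℝ⟦X⟧}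
    (hA : ∀ i ∈ t, SmoothCurve (A i)) :
    taylorCurve (fun s => ∑ i ∈ t, A i s) = ∑ i ∈ t, taylorCurve (A i) := by
  simp only [taylorCurve]
  rw [← map_sum]
  congr 1
  ext1 k
  simp only [coeff_mk, map_sum]
  exact taylor_sum _ fun i hi => hA i hi k

theorem taylorCurve_add {A B : ℝ → ℝ⟦X⟧} (hA : SmoothCurve A) (hB : SmoothCurve B) :
    taylorCurve (fun s => A s + B s) = taylorCurve A + taylorCurve B := by
  have := taylorCurve_sum Finset.univ (A := ![A, B])
    (fun i _ => by fin_cases i <;> assumption)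
  simpa using this

end Curves

section Pull

open PowerSeries
open Finset.HasAntidiagonal (antidiagonal mem_antidiagonal)

variable (I) in
/-- A family of maps of `M` to itself, smooth jointly in the parameter and the point, with
invertible differentials. -/
structure SmoothMotion (G : ℝ → M → M) : Prop where
  smooth : ContMDiff (𝓘(ℝ, ℝ).prod I) I ∞ (fun p : ℝ × M => G p.1 p.2)
  invertible : ∀ s x, (mfderiv I I (G s) x).IsInvertible

/-- The pullback of a formal power series of functions by the Taylor series of a family of
maps. -/
def pull (G : ℝ → M → M) (a : ℕ → M → ℝ) (n : ℕ) (x : M) : ℝ :=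
  ∑ p ∈ antidiagonal n, coeff p.1 (taylor fun s => a p.2 (G s x))

omit [TopologicalSpace M] in
theorem ev_pull (G : ℝ → M → M) (a : ℕ → M → ℝ) (x : M) :
    ev (pull G a) x = taylorCurve fun s => ev a (G s x) := by
  ext n
  simp only [coeff_ev, pull, coeff_taylorCurve]

variable {G : ℝ → M → M}

theorem SmoothMotion.contMDiff (hG : SmoothMotion I G) (s : ℝ) : ContMDiff I I ∞ (G s) :=
  hG.smooth.comp (contMDiff_const.prodMk contMDiff_id)

theorem SmoothMotion.mdifferentiableAt (hG : SmoothMotion I G) (s : ℝ) (x : M) :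
    MDifferentiableAt I I (G s) x :=
  (hG.contMDiff s).mdifferentiable (by simp) x

theorem SmoothMotion.continuous (hG : SmoothMotion I G) (x : M) : Continuous fun s => G s x :=
  hG.smooth.continuous.comp (by fun_prop : Continuous fun s : ℝ => (s, x))

theorem SmoothMotion.comp (hG : SmoothMotion I G) {g : M → ℝ} (hg : ContMDiff I 𝓘(ℝ, ℝ) ∞ g) :
    SmoothFamily I fun s x => g (G s x) :=
  (smoothFamily_const hg).comp hG.smooth

theorem dAt_comp {g : M → ℝ} (hg : ContMDiff I 𝓘(ℝ, ℝ) ∞ g) {u : M → M} {x : M}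
    (hu : MDifferentiableAt I I u x) (v : TangentSpace I x) :
    dAt (fun x => g (u x)) v = dAt g (mfderiv I I u x v) :=
  mfderiv_comp_apply x (hg.mdifferentiable (by simp) _) hu v

theorem SmoothMotion.smoothCurve_ev (hG : SmoothMotion I G) {a : ℕ → M → ℝ}
    (ha : SmoothSeries I a) (x : M) : SmoothCurve fun s => ev a (G s x) := fun k => by
  simpa using (hG.comp (ha k)).contDiff x

variable [I.Boundaryless] [IsManifold I ∞ M]

theorem SmoothMotion.smoothCurve_dev (hG : SmoothMotion I G) {a : ℕ → M → ℝ}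
    (ha : SmoothSeries I a) {x : M} (v : TangentSpace I x) :
    SmoothCurve fun s => dev a (mfderiv I I (G s) x v) := fun k => by
  have h1 := (hG.comp (ha k)).contDiff_mfderiv x v
  have h2 : ∀ s, coeff k (dev a (mfderiv I I (G s) x v)) = dAt (fun x => a k (G s x)) v :=
    fun s => by rw [coeff_dev, dAt_comp (ha k) (hG.mdifferentiableAt s x)]
  simpa only [h2] using! h1

theorem SmoothMotion.smoothSeries_pull (hG : SmoothMotion I G) {a : ℕ → M → ℝ}
    (ha : SmoothSeries I a) : SmoothSeries I (pull G a) :=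
  fun _ => contMDiff_finsetSum _ fun p _ => (hG.comp (ha p.2)).contMDiff_taylor p.1

theorem SmoothMotion.dev_pull (hG : SmoothMotion I G) {a : ℕ → M → ℝ}
    (ha : SmoothSeries I a) {x : M} (v : TangentSpace I x) :
    dev (pull G a) v = taylorCurve fun s => dev a (mfderiv I I (G s) x v) := by
  ext n
  have h1 : pull G a n = fun x => ∑ p ∈ antidiagonal n, coeff p.1 (taylor fun s => a p.2 (G s x)) :=
    rfl
  rw [coeff_dev, coeff_taylorCurve, h1,
    dAt_sum _ fun p _ => (hG.comp (ha p.2)).contMDiff_taylor p.1]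
  refine Finset.sum_congr rfl fun p _ => ?_
  rw [(hG.comp (ha p.2)).dAt_taylor]
  congr 2
  ext s
  rw [coeff_dev, dAt_comp (ha p.2) (hG.mdifferentiableAt s x)]

theorem SmoothMotion.smoothCurve_tri (hG : SmoothMotion I G) {f g h : ℕ → M → ℝ}
    (hf : SmoothSeries I f) (hg : SmoothSeries I g) (hh : SmoothSeries I h) {x : M}
    (v w : TangentSpace I x) :
    SmoothCurve fun s => tri f g h (mfderiv I I (G s) x v) (mfderiv I I (G s) x w) :=
  ((hG.smoothCurve_ev hf x).mul (hG.smoothCurve_dev hg v)).mul (hG.smoothCurve_dev hh w)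

theorem SmoothMotion.tri_pull (hG : SmoothMotion I G) {f g h : ℕ → M → ℝ}
    (hf : SmoothSeries I f) (hg : SmoothSeries I g) (hh : SmoothSeries I h) {x : M}
    (v w : TangentSpace I x) :
    tri (pull G f) (pull G g) (pull G h) v w =
      taylorCurve fun s => tri f g h (mfderiv I I (G s) x v) (mfderiv I I (G s) x w) := by
  simp only [tri]
  rw [taylorCurve_mul ((hG.smoothCurve_ev hf x).mul (hG.smoothCurve_dev hg v))
    (hG.smoothCurve_dev hh w), taylorCurve_mul (hG.smoothCurve_ev hf x) (hG.smoothCurve_dev hg v),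
    ev_pull, hG.dev_pull hg, hG.dev_pull hh]

theorem SmoothMotion.smoothCurve_leib (hG : SmoothMotion I G) {f g h f' g' h' : ℕ → M → ℝ}
    (hf : SmoothSeries I f) (hg : SmoothSeries I g) (hh : SmoothSeries I h)
    (hf' : SmoothSeries I f') (hg' : SmoothSeries I g') (hh' : SmoothSeries I h') {x : M}
    (v w : TangentSpace I x) :
    SmoothCurve fun s => leib f g h f' g' h' (mfderiv I I (G s) x v) (mfderiv I I (G s) x w) :=
  ((hG.smoothCurve_tri hf' hg hh v w).add (hG.smoothCurve_tri hf hg' hh v w)).add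
    (hG.smoothCurve_tri hf hg hh' v w)

theorem SmoothMotion.leib_pull (hG : SmoothMotion I G) {f g h f' g' h' : ℕ → M → ℝ}
    (hf : SmoothSeries I f) (hg : SmoothSeries I g) (hh : SmoothSeries I h)
    (hf' : SmoothSeries I f') (hg' : SmoothSeries I g') (hh' : SmoothSeries I h') {x : M}
    (v w : TangentSpace I x) :
    leib (pull G f) (pull G g) (pull G h) (pull G f') (pull G g') (pull G h') v w =
      taylorCurve fun s => leib f g h f' g' h' (mfderiv I I (G s) x v) (mfderiv I I (G s) x w) := by
  simp only [leib]
  rw [taylorCurve_add ((hG.smoothCurve_tri hf' hg hh v w).add (hG.smoothCurve_tri hf hg' hh v w))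
    (hG.smoothCurve_tri hf hg hh' v w), taylorCurve_add (hG.smoothCurve_tri hf' hg hh v w)
    (hG.smoothCurve_tri hf hg' hh v w), hG.tri_pull hf' hg hh, hG.tri_pull hf hg' hh,
    hG.tri_pull hf hg hh']

theorem contDiffAt_of_clm_apply [FiniteDimensional ℝ E] {V : Type*} [NormedAddCommGroup V]
    [NormedSpace ℝ V] {L : ℝ → E →L[ℝ] V} {s : ℝ}
    (h : ∀ v, ContDiffAt ℝ ∞ (fun s => L s v) s) : ContDiffAt ℝ ∞ L s := by
  have : CompleteSpace E := FiniteDimensional.complete ℝ E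
  let b := Module.finBasis ℝ E
  have h1 : L = fun s => ∑ i, (LinearMap.toContinuousLinearMap (b.coord i)).smulRight
      (L s (b i)) := by
    ext s v
    rw [sum_apply]
    conv_lhs => rw [← b.sum_repr v, map_sum]
    exact Finset.sum_congr rfl fun i _ => by simp
  rw [h1]
  exact ContDiffAt.sum fun i _ => contDiffAt_const.smulRight (h (b i))

theorem SmoothMotion.contDiff_mpullback [FiniteDimensional ℝ E] (hG : SmoothMotion I G)
    {X : (m : M) → TangentSpace I m}
    (hX : ContMDiff I I.tangent ∞ (fun m => (X m : TangentBundle I M))) (x : M) :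
    ContDiff (F := E) ℝ ∞ fun s => (VectorField.mpullback I I (G s) X x : E) := by
  have : CompleteSpace E := FiniteDimensional.complete ℝ E
  refine contDiff_iff_contDiffAt.2 fun s₀ => ?_
  set p := G s₀ x with hp
  have hsrc : ∀ᶠ s in nhds s₀, G s x ∈ (chartAt H p).source :=
    (hG.continuous x).continuousAt ((chartAt H p).open_source.mem_nhds (mem_chart_source H p))
  let L : ℝ → E →L[ℝ] E := fun s => mfderiv I 𝓘(ℝ, E) (fun y => extChartAt I p (G s y)) x
  let Z : ℝ → E := fun s => mfderiv I 𝓘(ℝ, E) (extChartAt I p) (G s x) (X (G s x))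
  have hL : ContDiffAt ℝ ∞ L s₀ := by
    refine contDiffAt_of_clm_apply (E := E) (L := L) fun v => ?_
    have h1 : ∀ᶠ s in nhds s₀, ContMDiffAt (𝓘(ℝ, ℝ).prod I) 𝓘(ℝ, E) ∞
        (fun p' : ℝ × M => extChartAt I p (G p'.1 p'.2)) (s, x) := by
      filter_upwards [hsrc] with s hs
      exact (contMDiffAt_extChartAt' hs).comp (s, x) hG.smooth.contMDiffAt
    exact contDiffAt_mfderiv_family (E' := E) (h := fun s y => extChartAt I p (G s y)) h1 v
  have hZ : ContDiffAt ℝ ∞ Z s₀ := by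
    have h1 := contMDiffAt_mfderiv_extChartAt (x₀ := p) (hX p)
    have h2 : ContMDiff 𝓘(ℝ, ℝ) I ∞ fun s => G s x :=
      hG.smooth.comp (contMDiff_id.prodMk contMDiff_const)
    exact (h1.comp s₀ h2.contMDiffAt).contDiffAt
  have hc : ∀ {y : M}, y ∈ (chartAt H p).source →
      (mfderiv I 𝓘(ℝ, E) (extChartAt I p) y).IsInvertible :=
    fun hy => isInvertible_mfderiv_extChartAt (by simpa using hy)
  let A : ℝ → E →L[ℝ] E := fun s => mfderiv I 𝓘(ℝ, E) (extChartAt I p) (G s x)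
  let B : ℝ → E →L[ℝ] E := fun s => mfderiv I I (G s) x
  have hLAB : ∀ s, G s x ∈ (chartAt H p).source → L s = (A s).comp (B s) := fun s hs =>
    mfderiv_comp x (mdifferentiableAt_extChartAt hs) (hG.mdifferentiableAt s x)
  have key : ∀ A B : E →L[ℝ] E, A.IsInvertible → ∀ z, B.inverse z = (A.comp B).inverse (A z) :=
    fun A B hA z => by rw [hA.inverse_comp_apply_of_left, hA.inverse_apply_self]
  have h1 : (fun s => VectorField.mpullback I I (G s) X x : ℝ → E) =ᶠ[nhds s₀]
      fun s => (L s).inverse (Z s) := by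
    filter_upwards [hsrc] with s hs
    rw [hLAB s hs]
    exact key (A s) (B s) (hc hs) (X (G s x))
  have h2 : (L s₀).IsInvertible := by
    rw [hLAB s₀ hsrc.self_of_nhds]
    have hA : (A s₀).IsInvertible := hc hsrc.self_of_nhds
    exact hA.comp (hG.invertible s₀ x)
  exact ContDiffAt.congr_of_eventuallyEq
    ((h2.contDiffAt_map_inverse.comp s₀ hL).clm_apply hZ) h1

end Pull

section Commutation

open PowerSeries
open Finset.HasAntidiagonal (antidiagonal mem_antidiagonal)

theorem coeff_taylor_clm {V : Type*} [NormedAddCommGroup V] [NormedSpace ℝ V] (L : V →L[ℝ] ℝ)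
    {y : ℝ → V} (hy : ContDiff ℝ ∞ y) (k : ℕ) :
    coeff k (taylor fun s => L (y s)) = L ((k ! : ℝ)⁻¹ • iteratedDeriv k y 0) := by
  have h1 : ∀ k s, iteratedDeriv k (fun s => L (y s)) s = L (iteratedDeriv k y s) := by
    intro k
    induction k with
    | zero => simp
    | succ k ih =>
      intro s
      rw [iteratedDeriv_succ, iteratedDeriv_succ, funext ih]
      have h2 := (hy.differentiable_iteratedDeriv k (WithTop.coe_lt_coe.2 (ENat.natCast_lt_top k))) s
      exact (L.hasFDerivAt.comp_hasDerivAt s h2.hasDerivAt).deriv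
  rw [coeff_taylor, h1, map_smul, smul_eq_mul]

theorem sum_coord_mul [FiniteDimensional ℝ E] (b : Module.Basis (Fin (Module.finrank ℝ E)) ℝ E)
    (L : E →L[ℝ] ℝ) (y : E) : L y = ∑ i, b.coord i y * L (b i) := by
  conv_lhs => rw [← b.sum_repr y, map_sum]
  exact Finset.sum_congr rfl fun i _ => by simp

variable [IsManifold I ∞ M] [I.Boundaryless] [FiniteDimensional ℝ E]

theorem SmoothMotion.formalAct_pull {G : ℝ → M → M} (hG : SmoothMotion I G)
    {R : ℕ → (m : M) → TangentSpace I m}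
    (hR : ∀ k, ContMDiff I I.tangent ∞ (fun m => (R k m : TangentBundle I M)))
    (hinv : ∀ n x, ∑ p ∈ antidiagonal n, (p.1 ! : ℝ)⁻¹ • iteratedDeriv (F := E) p.1
      (fun s => VectorField.mpullback I I (G s) (R p.2) x) 0 = (R n x : E))
    {a : ℕ → M → ℝ} (ha : SmoothSeries I a) :
    formalAct R (pull G a) = pull G (formalAct R a) := by
  let b := Module.finBasis ℝ E
  have key : ∀ x, ev (formalAct R (pull G a)) x = ev (pull G (formalAct R a)) x := by
    intro x
    let e : Fin (Module.finrank ℝ E) → TangentSpace I x := fun i => b i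
    let y : ℕ → ℝ → E := fun l s => VectorField.mpullback I I (G s) (R l) x
    let c : Fin (Module.finrank ℝ E) → E →L[ℝ] ℝ := fun i =>
      LinearMap.toContinuousLinearMap (b.coord i)
    let r : Fin (Module.finrank ℝ E) → ℝ → ℝ⟦X⟧ := fun i s => PowerSeries.mk fun l => c i (y l s)
    have hy : ∀ l, ContDiff ℝ ∞ (y l) := fun l => hG.contDiff_mpullback (hR l) x
    have hr : ∀ i, SmoothCurve (r i) := fun i l => by
      simp only [r, coeff_mk]
      exact (c i).contDiff.comp (hy l)
    have h1 : ∀ l k s, dAt (a k) (R l (G s x)) =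
        ∑ i, c i (y l s) * dAt (a k) (mfderiv I I (G s) x (e i)) := by
      intro l k s
      let A : E →L[ℝ] E := mfderiv I I (G s) x
      let D : E →L[ℝ] ℝ := mfderiv I 𝓘(ℝ, ℝ) (a k) (G s x)
      have hA : A (y l s) = R l (G s x) := (hG.invertible s x).self_apply_inverse (R l (G s x))
      have h2 := sum_coord_mul b (D.comp A) (y l s)
      rw [ContinuousLinearMap.comp_apply, hA] at h2
      exact h2
    have h2 : ∀ s, ev (formalAct R a) (G s x) =
        ∑ i, r i s * dev a (mfderiv I I (G s) x (e i)) := by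
      intro s
      ext n
      simp only [coeff_ev, formalAct, map_sum, coeff_mul, coeff_dev, r, coeff_mk, dirDeriv_eq_dAt,
        h1]
      exact Finset.sum_comm
    have h3 : ∀ i, taylorCurve (r i) = PowerSeries.mk fun n => c i (R n x) := by
      intro i
      ext n
      rw [coeff_taylorCurve, coeff_mk, ← hinv n x, map_sum]
      refine Finset.sum_congr rfl fun p _ => ?_
      simp only [r, coeff_mk]
      exact coeff_taylor_clm (c i) (hy p.2) p.1
    rw [ev_pull, funext h2, taylorCurve_sum _ fun i _ => (hr i).mul (hG.smoothCurve_dev ha (e i))]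
    ext n
    simp only [taylorCurve_mul (hr _) (hG.smoothCurve_dev ha (e _)), ← hG.dev_pull ha, h3,
      map_sum, coeff_mul, coeff_mk, coeff_dev, coeff_ev, formalAct, dirDeriv_eq_dAt]
    rw [Finset.sum_comm]
    refine Finset.sum_congr rfl fun p _ => ?_
    exact sum_coord_mul b (mfderiv I 𝓘(ℝ, ℝ) (pull G a p.2) x) (R p.1 x)
  ext n x
  simpa using congrArg (coeff n) (key x)

end Commutation

section Expression

open PowerSeries
open Finset.HasAntidiagonal (antidiagonal mem_antidiagonal)

variable [IsManifold I ∞ M]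

/-- An expression of the Taylor series of `Ω_γ` as a finite sum of formal tensors `f dg ⊗ dh` on an
open set. -/
structure Expression (Ω : PresymplecticForm I M Γ) (γ : Γ) (U : Set M) where
  ι : Type
  fintype : Fintype ι
  f : ι → ℕ → M → ℝ
  g : ι → ℕ → M → ℝ
  h : ι → ℕ → M → ℝ
  smooth_f : ∀ i, SmoothSeries I (f i)
  smooth_g : ∀ i, SmoothSeries I (g i)
  smooth_h : ∀ i, SmoothSeries I (h i)
  isOpen : IsOpen U
  term_eq : ∀ x ∈ U, ∀ k (v w : TangentSpace I x),
    Ω.term k γ x v w = ∑ i, coeff k (tri (f i) (g i) (h i) v w)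

attribute [instance] Expression.fintype

variable {Ω : PresymplecticForm I M Γ} {γ : Γ}

/-- The Leibniz expression for the Lie derivative along a formal vector field. -/
def Expression.leibSum {U : Set M} (A : Expression Ω γ U) (R : ℕ → (m : M) → TangentSpace I m)
    (n : ℕ) {x : M} (v w : TangentSpace I x) : ℝ :=
  ∑ i, coeff n (leib (A.f i) (A.g i) (A.h i) (formalAct R (A.f i)) (formalAct R (A.g i))
    (formalAct R (A.h i)) v w)

/-- The expression given by a representation. -/
def Representation.expression [I.Boundaryless] {K : Set M} (A : Representation Ω γ K) :
    Expression Ω γ A.domain where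
  ι := A.ι
  fintype := A.fintype
  f := A.f
  g := A.g
  h := A.h
  smooth_f := A.smooth_f
  smooth_g := A.smooth_g
  smooth_h := A.smooth_h
  isOpen := A.isOpen_domain
  term_eq := fun _ hx => A.term_eq hx

variable [I.Boundaryless] [FiniteDimensional ℝ E]

theorem Expression.sum_lieDeriv {U : Set M} (A : Expression Ω γ U)
    {R : ℕ → (m : M) → TangentSpace I m}
    (hR : ∀ k, ContMDiff I I.tangent ∞ (fun m => (R k m : TangentBundle I M)))
    {x : M} (hx : x ∈ U) (n : ℕ) (Y Z : SmoothVectorField I M) :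
    ∑ p ∈ antidiagonal n, lieDeriv (R p.1) (Ω.term p.2 γ) Y Z x = A.leibSum R n (Y x) (Z x) := by
  have : CompleteSpace E := FiniteDimensional.complete ℝ E
  rw [Expression.leibSum]
  simp only [coeff_leib_formalAct (A.smooth_g _) (A.smooth_h _) hR]
  rw [Finset.sum_comm]
  refine Finset.sum_congr rfl fun p _ => ?_
  refine lieDeriv_eq_leib A.smooth_f A.smooth_g A.smooth_h (hR p.1) ?_ Y Z
  filter_upwards [A.isOpen.mem_nhds hx] with y hy using A.term_eq y hy p.2

variable [T2Space M]

/-- A smooth vector field with a given value at a point. -/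
def extend {x : M} (v : TangentSpace I x) : SmoothVectorField I M :=
  (exists_smoothVectorField x v).choose

omit [I.Boundaryless] in
theorem extend_apply {x : M} (v : TangentSpace I x) : extend v x = v :=
  (exists_smoothVectorField x v).choose_spec

variable (Ω γ) in
/-- The term of order `n` of the formal Lie derivative, as a function of two tangent vectors. -/
def formalLie (R : ℕ → (m : M) → TangentSpace I m) (n : ℕ) {x : M} (v w : TangentSpace I x) : ℝ :=
  ∑ p ∈ antidiagonal n, lieDeriv (R p.1) (Ω.term p.2 γ) (extend v) (extend w) x

variable {R : ℕ → (m : M) → TangentSpace I m}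
    (hR : ∀ k, ContMDiff I I.tangent ∞ (fun m => (R k m : TangentBundle I M)))

include hR

theorem Expression.formalLie_eq {U : Set M} (A : Expression Ω γ U)
    {x : M} (hx : x ∈ U) (n : ℕ) (v w : TangentSpace I x) :
    formalLie Ω γ R n v w = A.leibSum R n v w := by
  rw [formalLie, A.sum_lieDeriv hR hx, extend_apply, extend_apply]

theorem sum_lieDeriv_eq_formalLie (n : ℕ) (x : M) (Y Z : SmoothVectorField I M) :
    ∑ p ∈ antidiagonal n, lieDeriv (R p.1) (Ω.term p.2 γ) Y Z x =
      formalLie Ω γ R n (Y x) (Z x) := by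
  obtain ⟨A⟩ := nonempty_representation Ω γ (isCompact_singleton (x := x))
  have hx : x ∈ A.domain := A.subset_domain rfl
  rw [A.expression.sum_lieDeriv hR hx, A.expression.formalLie_eq hR hx]

omit hR

theorem coeff_taylor_form (x : M) (v w : TangentSpace I x) (n : ℕ) :
    coeff n (taylor fun s => Ω.form (s • γ) x v w) = Ω.term n γ x v w := by
  obtain ⟨A⟩ := nonempty_representation Ω γ (isCompact_singleton (x := x))
  have hx : x ∈ A.domain := A.subset_domain rfl
  rw [A.term_eq hx, ← map_sum, funext fun s => A.form_eq x hx s v w, taylor_sum]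
  · congr 1
    refine Finset.sum_congr rfl fun i _ => ?_
    have h1 := (A.coef_smooth i).contDiff x
    rw [taylor_mul (h1.mul contDiff_const) contDiff_const, taylor_mul h1 contDiff_const,
      taylor_const, taylor_const, tri, Representation.f, Representation.g, Representation.h,
      ev_taylorSeries, dev_constSeries, dev_constSeries]
  · intro i _
    exact (((A.coef_smooth i).contDiff x).mul contDiff_const).mul contDiff_const

omit [FiniteDimensional ℝ E] [T2Space M] in
theorem SmoothMotion.contDiff_dAt {G : ℝ → M → M} (hG : SmoothMotion I G) {g : M → ℝ}
    (hg : ContMDiff I 𝓘(ℝ, ℝ) ∞ g) {x : M} (v : TangentSpace I x) :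
    ContDiff ℝ ∞ fun s => dAt g (mfderiv I I (G s) x v) := by
  have h1 : (fun s => dAt g (mfderiv I I (G s) x v)) =
      fun s => (mfderiv I 𝓘(ℝ, ℝ) (fun y => g (G s y)) x v : ℝ) :=
    funext fun s => (dAt_comp hg (hG.mdifferentiableAt s x) v).symm
  rw [h1]
  exact (hG.comp hg).contDiff_mfderiv x v

omit [FiniteDimensional ℝ E] [T2Space M] in
theorem taylorCurve_coef {G : ℝ → M → M} (hG : SmoothMotion I G) {K : Set M}
    (A : Representation Ω γ K) (i : A.ι) {x : M} (v w : TangentSpace I x) :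
    (taylorCurve fun s => tri (A.f i) (A.g i) (A.h i) (mfderiv I I (G s) x v)
      (mfderiv I I (G s) x w)) = taylor fun s => A.coef i s (G s x) *
        dAt (A.left i) (mfderiv I I (G s) x v) * dAt (A.right i) (mfderiv I I (G s) x w) := by
  have hconst : ∀ {c : ℝ → ℝ}, ContDiff ℝ ∞ c → SmoothFamily 𝓘(ℝ, ℝ) fun _ δ => c δ :=
    fun hc => smoothFamily_const hc.contMDiff
  have h1 : SmoothFamily 𝓘(ℝ, ℝ) fun s δ => A.coef i s (G δ x) :=
    ContMDiff.comp (A.coef_smooth i) (contMDiff_fst.prodMk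
      (hG.smooth.comp (contMDiff_snd.prodMk contMDiff_const)))
  have h2 : SmoothFamily 𝓘(ℝ, ℝ) fun s δ => A.coef i s (G δ x) *
        dAt (A.left i) (mfderiv I I (G δ) x v) * dAt (A.right i) (mfderiv I I (G δ) x w) :=
    ContMDiff.mul (ContMDiff.mul h1 (hconst (hG.contDiff_dAt (A.left_smooth i) v)))
      (hconst (hG.contDiff_dAt (A.right_smooth i) w))
  rw [taylor_diagonal h2, taylorCurve]
  congr 2
  ext1 k
  congr 1
  ext δ
  have h3 := (A.coef_smooth i).contDiff (G δ x)
  rw [taylor_mul (h3.mul contDiff_const) contDiff_const, taylor_mul h3 contDiff_const,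
      taylor_const, taylor_const, tri, Representation.f, Representation.g, Representation.h,
      ev_taylorSeries, dev_constSeries, dev_constSeries]

/-- The expression obtained by pulling back a representation. -/
def Representation.pullExpression {G : ℝ → M → M} (hG : SmoothMotion I G)
    (hΩ : ∀ (s : ℝ) (x : M) (v w : TangentSpace I x),
      Ω.form (s • γ) (G s x) (mfderiv I I (G s) x v) (mfderiv I I (G s) x w)
        = Ω.form (s • γ) x v w) {K : Set M} (A : Representation Ω γ K) :
    Expression Ω γ (G 0 ⁻¹' A.domain) where
  ι := A.ι
  fintype := A.fintype
  f i := pull G (A.f i)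
  g i := pull G (A.g i)
  h i := pull G (A.h i)
  smooth_f i := hG.smoothSeries_pull (A.smooth_f i)
  smooth_g i := hG.smoothSeries_pull (A.smooth_g i)
  smooth_h i := hG.smoothSeries_pull (A.smooth_h i)
  isOpen := A.isOpen_domain.preimage (hG.contMDiff 0).continuous
  term_eq x hx k v w := by
    rw [← coeff_taylor_form, ← map_sum]
    have h1 : ∀ᶠ s in nhds (0 : ℝ), G s x ∈ A.domain :=
      (hG.continuous x).continuousAt (A.isOpen_domain.mem_nhds hx)
    have h2 : (fun s => Ω.form (s • γ) x v w) =ᶠ[nhds 0] fun s => ∑ i, A.coef i s (G s x) *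
        dAt (A.left i) (mfderiv I I (G s) x v) * dAt (A.right i) (mfderiv I I (G s) x w) := by
      filter_upwards [h1] with s hs
      rw [← hΩ, A.form_eq _ hs]
    rw [taylor_congr h2, taylor_sum]
    · congr 1
      refine Finset.sum_congr rfl fun i _ => ?_
      rw [hG.tri_pull (A.smooth_f i) (A.smooth_g i) (A.smooth_h i), taylorCurve_coef hG]
    · intro i _
      exact ((((A.coef_smooth i).comp hG.smooth).contDiff x).mul (hG.contDiff_dAt (A.left_smooth i) v)).mul
        (hG.contDiff_dAt (A.right_smooth i) w)

end Expression

section Invariance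

open PowerSeries
open Finset.HasAntidiagonal (antidiagonal mem_antidiagonal)

variable [IsManifold I ∞ M] [I.Boundaryless] [FiniteDimensional ℝ E] [T2Space M]
  {Ω : PresymplecticForm I M Γ} {γ : Γ} {R : ℕ → (m : M) → TangentSpace I m}

theorem formalLie_pull
    (hR : ∀ k, ContMDiff I I.tangent ∞ (fun m => (R k m : TangentBundle I M)))
    {G : ℝ → M → M} (hG : SmoothMotion I G)
    (hinv : ∀ n x, ∑ p ∈ antidiagonal n, (p.1 ! : ℝ)⁻¹ • iteratedDeriv (F := E) p.1
      (fun s => VectorField.mpullback I I (G s) (R p.2) x) 0 = (R n x : E))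
    (hΩ : ∀ (s : ℝ) (x : M) (v w : TangentSpace I x),
      Ω.form (s • γ) (G s x) (mfderiv I I (G s) x v) (mfderiv I I (G s) x w)
        = Ω.form (s • γ) x v w)
    {n : ℕ} (hn : ∀ j < n, ∀ (x : M) (v w : TangentSpace I x), formalLie Ω γ R j v w = 0)
    {x : M} (v w : TangentSpace I x) :
    formalLie Ω γ R n (mfderiv I I (G 0) x v) (mfderiv I I (G 0) x w) = formalLie Ω γ R n v w := by
  obtain ⟨A⟩ := nonempty_representation Ω γ (isCompact_singleton (x := G 0 x))
  have hx : G 0 x ∈ A.domain := A.subset_domain rfl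
  have h1 := (A.pullExpression hG hΩ).formalLie_eq hR (x := x) hx n v w
  have hact : ∀ {a : ℕ → M → ℝ}, SmoothSeries I a → SmoothSeries I (formalAct R a) :=
    fun ha => ha.formalAct hR
  have hc := fun i => hG.smoothCurve_leib (A.smooth_f i) (A.smooth_g i) (A.smooth_h i)
    (hact (A.smooth_f i)) (hact (A.smooth_g i)) (hact (A.smooth_h i)) v w
  have h2 : (A.pullExpression hG hΩ).leibSum R n v w = coeff n (taylorCurve fun s =>
      ∑ i, leib (A.f i) (A.g i) (A.h i) (formalAct R (A.f i)) (formalAct R (A.g i))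
        (formalAct R (A.h i)) (mfderiv I I (G s) x v) (mfderiv I I (G s) x w)) := by
    rw [taylorCurve_sum _ fun i _ => hc i, map_sum]
    refine Finset.sum_congr rfl fun i _ => ?_
    rw [← hG.leib_pull (A.smooth_f i) (A.smooth_g i) (A.smooth_h i)
      (hact (A.smooth_f i)) (hact (A.smooth_g i)) (hact (A.smooth_h i)) v w,
      ← hG.formalAct_pull hR hinv (A.smooth_f i), ← hG.formalAct_pull hR hinv (A.smooth_g i),
      ← hG.formalAct_pull hR hinv (A.smooth_h i)]
    rfl
  have h3 : ∀ᶠ s in nhds (0 : ℝ), G s x ∈ A.domain :=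
    (hG.continuous x).continuousAt (A.isOpen_domain.mem_nhds hx)
  have h4 : ∀ k, (fun s => coeff k (∑ i, leib (A.f i) (A.g i) (A.h i) (formalAct R (A.f i))
      (formalAct R (A.g i)) (formalAct R (A.h i)) (mfderiv I I (G s) x v)
      (mfderiv I I (G s) x w))) =ᶠ[nhds 0]
      fun s => formalLie Ω γ R k (mfderiv I I (G s) x v) (mfderiv I I (G s) x w) := by
    intro k
    filter_upwards [h3] with s hs
    rw [A.expression.formalLie_eq hR hs, map_sum]
    rfl
  rw [h1, h2, coeff_taylorCurve, Finset.sum_eq_single (0, n)]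
  · rw [taylor_coeff_zero]
    exact (h4 n).self_of_nhds.symm
  · rintro ⟨j, k⟩ hp hne
    rw [mem_antidiagonal] at hp
    have hj : j ≠ 0 := by
      rintro rfl
      simp_all
    have hk : k < n := by
      simp only at hp
      omega
    have h5 := (h4 k).trans (Filter.Eventually.of_forall fun s => hn k hk _ _ _)
    rw [taylor_congr h5, taylor_const]
    exact coeff_C_of_ne_zero hj
  · simp

omit [IsManifold I ∞ M] [I.Boundaryless] [FiniteDimensional ℝ E] [T2Space M] in
theorem CircleAction.smoothMotion (Φ : CircleAction I M) : SmoothMotion I Φ.toFun where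
  smooth := Φ.smooth
  invertible s x := by
    have hs : ∀ t, ContMDiff I I ∞ (Φ.toFun t) := fun t =>
      Φ.smooth.comp (contMDiff_const.prodMk contMDiff_id)
    have hd : ∀ t y, MDifferentiableAt I I (Φ.toFun t) y := fun t y =>
      (hs t).mdifferentiable (by simp) y
    have hinv : ∀ t y, Φ.toFun (-t) (Φ.toFun t y) = y := fun t y => by
      rw [← Φ.map_add, neg_add_cancel, Φ.map_zero]
    have key : ∀ t y, (mfderiv I I (Φ.toFun (-t)) (Φ.toFun t y)).comp
        (mfderiv I I (Φ.toFun t) y) = ContinuousLinearMap.id ℝ (TangentSpace I y) := by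
      intro t y
      have h1 := mfderiv_comp y (hd (-t) _) (hd t y)
      have h2 : Φ.toFun (-t) ∘ Φ.toFun t = id := funext (hinv t)
      rw [h2, mfderiv_id] at h1
      exact h1.symm
    have h1 := key (-s) (Φ.toFun s x)
    rw [neg_neg, hinv] at h1
    exact ContinuousLinearMap.IsInvertible.of_inverse h1 (key s x)

omit [IsManifold I ∞ M] [I.Boundaryless] [FiniteDimensional ℝ E] [T2Space M] in
theorem CircleAction.isCompact_orbit (Φ : CircleAction I M) (x : M) :
    IsCompact (Set.range fun t => Φ.toFun t x) := by
  have h1 : Function.Periodic (fun t => Φ.toFun t x) (2 * Real.pi) := fun t => by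
    simp only [Φ.map_add, Φ.map_two_pi]
  exact h1.compact_of_continuous Real.two_pi_pos.ne' (Φ.smoothMotion.continuous x)

theorem continuous_formalLie
    (hR : ∀ k, ContMDiff I I.tangent ∞ (fun m => (R k m : TangentBundle I M)))
    (Φ : CircleAction I M) (n : ℕ) {x : M} (v w : TangentSpace I x) :
    Continuous fun t => formalLie Ω γ R n (mfderiv I I (Φ.toFun t) x v)
      (mfderiv I I (Φ.toFun t) x w) := by
  obtain ⟨A⟩ := nonempty_representation Ω γ (Φ.isCompact_orbit x)
  have h1 : ∀ t, Φ.toFun t x ∈ A.domain := fun t => A.subset_domain ⟨t, rfl⟩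
  simp only [A.expression.formalLie_eq hR (h1 _), Expression.leibSum]
  refine continuous_finsetSum _ fun i _ => ?_
  exact (Φ.smoothMotion.smoothCurve_leib (A.smooth_f i) (A.smooth_g i) (A.smooth_h i)
    ((A.smooth_f i).formalAct hR) ((A.smooth_g i).formalAct hR) ((A.smooth_h i).formalAct hR)
    v w n).continuous

theorem formalLie_flow
    (hR : ∀ k, ContMDiff I I.tangent ∞ (fun m => (R k m : TangentBundle I M)))
    (Φ : CircleAction I M) {θ : ℝ} (hθ : ¬ ∃ q : ℚ, θ = (q : ℝ) * (2 * Real.pi)) {n : ℕ}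
    (hn : ∀ (x : M) (v w : TangentSpace I x), formalLie Ω γ R n (mfderiv I I (Φ.toFun θ) x v)
      (mfderiv I I (Φ.toFun θ) x w) = formalLie Ω γ R n v w) (t : ℝ)
    {x : M} (v w : TangentSpace I x) :
    formalLie Ω γ R n (mfderiv I I (Φ.toFun t) x v) (mfderiv I I (Φ.toFun t) x w) =
      formalLie Ω γ R n v w := by
  let c : ℝ → ℝ := fun t => formalLie Ω γ R n (mfderiv I I (Φ.toFun t) x v)
    (mfderiv I I (Φ.toFun t) x w)
  have hc : Continuous c := continuous_formalLie hR Φ n v w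
  have hd : ∀ t y, MDifferentiableAt I I (Φ.toFun t) y := Φ.smoothMotion.mdifferentiableAt
  have hcomp : ∀ t, (fun y => Φ.toFun θ (Φ.toFun t y)) = Φ.toFun (θ + t) :=
    fun t => funext fun y => (Φ.map_add θ t y).symm
  have h1 : ∀ t, c (θ + t) = c t := by
    intro t
    simp only [c]
    rw [← hcomp]
    refine Eq.trans ?_ (hn _ _ _)
    have h2 := fun u => mfderiv_comp_apply x (hd θ _) (hd t x) u
    have h3 := congrArg₂ (fun a b : TangentSpace I (Φ.toFun θ (Φ.toFun t x)) =>
      formalLie Ω γ R n a b) (h2 v) (h2 w)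
    exact h3
  have h2 : ∀ t, c (2 * Real.pi + t) = c t := by
    intro t
    have : Φ.toFun (2 * Real.pi + t) = Φ.toFun t :=
      funext fun y => by rw [Φ.map_add, Φ.map_two_pi]
    simp only [c]
    rw [this]
  let S : AddSubgroup ℝ :=
    { carrier := {p | ∀ t, c (p + t) = c t}
      zero_mem' := fun t => by rw [zero_add]
      add_mem' := fun {p q} hp hq t => by rw [add_assoc, hp, hq]
      neg_mem' := fun {p} hp t => by rw [← hp, add_neg_cancel_left] }
  have h3 : Dense (AddSubgroup.closure {θ, 2 * Real.pi} : Set ℝ) := by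
    rw [dense_addSubgroupClosure_pair_iff]
    rintro ⟨q, hq⟩
    refine hθ ⟨q, ?_⟩
    rw [hq, div_mul_cancel₀ _ Real.two_pi_pos.ne']
  have h4 : AddSubgroup.closure {θ, 2 * Real.pi} ≤ S := by
    rw [AddSubgroup.closure_le]
    rintro p (rfl | rfl)
    · exact h1
    · exact h2
  have h5 : c = fun _ => c 0 := by
    refine hc.ext_on h3 continuous_const fun p hp => ?_
    have := h4 hp 0
    rwa [add_zero] at this
  have h6 : c 0 = formalLie Ω γ R n v w := by
    have : Φ.toFun 0 = id := funext Φ.map_zero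
    simp only [c]
    rw [this, mfderiv_id]
    rfl
  exact (congrFun h5 t).trans h6

end Invariance

section FormalExponential

open PowerSeries
open Finset.HasAntidiagonal (antidiagonal mem_antidiagonal)

/-- Coefficientwise derivative of a curve of formal power series. -/
def HasSeriesDerivAt (A : ℝ → ℝ⟦X⟧) (A' : ℝ⟦X⟧) (t : ℝ) : Prop :=
  ∀ k, HasDerivAt (fun s => coeff k (A s)) (coeff k A') t

theorem HasSeriesDerivAt.mul {A B : ℝ → ℝ⟦X⟧} {A' B' : ℝ⟦X⟧} {t : ℝ}
    (hA : HasSeriesDerivAt A A' t) (hB : HasSeriesDerivAt B B' t) :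
    HasSeriesDerivAt (fun s => A s * B s) (A' * B t + A t * B') t := by
  intro k
  simp only [coeff_mul, map_add]
  rw [← Finset.sum_add_distrib]
  exact HasDerivAt.fun_sum fun p _ => (hA p.1).mul (hB p.2)

/-- A smooth solution, equal to `a` at times `0` and `2π`, of the formal evolution equation. -/
structure IsPeriodicSolution (R : ℕ → (m : M) → TangentSpace I m) (a : ℕ → M → ℝ)
    (U : ℕ → ℝ → M → ℝ) : Prop where
  smooth : ∀ n, SmoothFamily I (U n)
  zero : ∀ n x, U n 0 x = a n x
  two_pi : ∀ n x, U n (2 * Real.pi) x = a n x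
  hasDerivAt : ∀ n t x, HasDerivAt (fun s => U n s x) (formalAct R (fun k => U k t) n x) t

theorem sum_antidiagonal_assoc (n : ℕ) (T : ℕ → ℕ → ℕ → ℝ) :
    ∑ p ∈ antidiagonal n, ∑ q ∈ antidiagonal p.2, T p.1 q.1 q.2 =
      ∑ p ∈ antidiagonal n, ∑ q ∈ antidiagonal p.1, T q.1 q.2 p.2 := by
  simp only [Finset.sum_sigma']
  refine Finset.sum_nbij' (fun c => ⟨(c.1.1 + c.2.1, c.2.2), (c.1.1, c.2.1)⟩)
    (fun c => ⟨(c.2.1, c.2.2 + c.1.2), (c.2.2, c.1.2)⟩) ?_ ?_ ?_ ?_ fun _ _ => rfl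
  all_goals
    rintro ⟨⟨i, j⟩, ⟨k, l⟩⟩ h
    simp only [Finset.mem_sigma, mem_antidiagonal] at h ⊢
  · obtain ⟨rfl, rfl⟩ := h
    exact ⟨by ring, trivial⟩
  · obtain ⟨rfl, rfl⟩ := h
    exact ⟨by ring, trivial⟩
  · obtain ⟨-, rfl⟩ := h
    rfl
  · obtain ⟨-, rfl⟩ := h
    rfl

theorem exists_isPeriodicSolution [IsManifold I ∞ M] {R : FormalVectorField I M Γ}
    (hexp : ExpTwoPiEqOne R) (γ : Γ) {a : ℕ → M → ℝ} (ha : SmoothSeries I a) :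
    ∃ U, IsPeriodicSolution (fun k => R.term k γ) a U := by
  choose u hu h0 hpos using fun j => hexp γ (a j) (ha j)
  have hs : ∀ j k, SmoothFamily I (u j k) := fun j k => (hu j).smooth k
  refine ⟨fun n t x => ∑ p ∈ antidiagonal n, u p.2 p.1 t x, ?_, ?_, ?_, ?_⟩
  · intro n
    exact contMDiff_finsetSum _ fun p _ => hs p.2 p.1
  · intro n x
    rw [Finset.sum_eq_single (0, n)]
    · exact (hu n).init_zero x
    · rintro ⟨k, j⟩ hp hne
      rw [mem_antidiagonal] at hp
      refine (hu j).init_pos k (Nat.pos_of_ne_zero ?_) x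
      rintro rfl
      simp_all
    · simp
  · intro n x
    rw [Finset.sum_eq_single (0, n)]
    · exact h0 n x
    · rintro ⟨k, j⟩ hp hne
      rw [mem_antidiagonal] at hp
      refine hpos j k (Nat.pos_of_ne_zero ?_) x
      rintro rfl
      simp_all
    · simp
  · intro n t x
    have h1 : formalAct (fun k => R.term k γ) (fun k x => ∑ p ∈ antidiagonal k, u p.2 p.1 t x) n x =
        ∑ p ∈ antidiagonal n, ∑ q ∈ antidiagonal p.1, dirDeriv (R.term q.1 γ) (u p.2 q.2 t) x := by
      have h2 : ∀ l k, dirDeriv (R.term l γ) (fun x => ∑ p ∈ antidiagonal k, u p.2 p.1 t x) x =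
          ∑ p ∈ antidiagonal k, dirDeriv (R.term l γ) (u p.2 p.1 t) x := fun l k =>
        dAt_sum _ (fun p _ => (hs p.2 p.1).contMDiff t) _
      simp only [formalAct, h2]
      exact sum_antidiagonal_assoc n fun i j k => dirDeriv (R.term i γ) (u k j t) x
    rw [h1]
    exact HasDerivAt.fun_sum fun p _ => (hu p.2).evolution p.1 t x

variable [IsManifold I ∞ M] [I.Boundaryless]

omit [I.Boundaryless] [IsManifold I ∞ M] in
theorem leib_sub {f g h f' g' h' f'' g'' h'' : ℕ → M → ℝ}
    (hg' : SmoothSeries I g') (hh' : SmoothSeries I h')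
    (hg'' : SmoothSeries I g'') (hh'' : SmoothSeries I h'') {x : M} (v w : TangentSpace I x) :
    leib f g h (fun n x => f' n x - f'' n x) (fun n x => g' n x - g'' n x)
      (fun n x => h' n x - h'' n x) v w =
      leib f g h f' g' h' v w - leib f g h f'' g'' h'' v w := by
  have h1 : ev (fun n x => f' n x - f'' n x) x = ev f' x - ev f'' x := by
    ext n
    simp
  have h2 : ∀ {a b : ℕ → M → ℝ}, SmoothSeries I a → SmoothSeries I b → ∀ v : TangentSpace I x,
      dev (fun n x => a n x - b n x) v = dev a v - dev b v := by
    intro a b ha hb v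
    ext n
    simp only [coeff_dev, map_sub]
    exact dAt_sub (ha n) (hb n) v
  simp only [leib, tri, h1, h2 hg' hg'', h2 hh' hh'']
  ring

omit [I.Boundaryless] [IsManifold I ∞ M] in
theorem leib_zero (f g h : ℕ → M → ℝ) {x : M} (v w : TangentSpace I x) :
    leib f g h (fun _ _ => 0) (fun _ _ => 0) (fun _ _ => 0) v w = 0 := by
  have h1 : ev (fun _ _ => 0 : ℕ → M → ℝ) x = 0 := by
    ext n
    simp
  have h2 : ∀ v : TangentSpace I x, dev (fun _ _ => 0 : ℕ → M → ℝ) v = 0 := by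
    intro v
    ext n
    simp only [coeff_dev, map_zero]
    exact congrArg (fun L : E →L[ℝ] ℝ => L v) (mfderiv_const (I := I) (I' := 𝓘(ℝ, ℝ)) (c := (0 : ℝ)))
  simp [leib, tri, h1, h2]

variable {Φ : CircleAction I M} {X₀ : (m : M) → TangentSpace I m}

omit [I.Boundaryless] [IsManifold I ∞ M] in
theorem IsInfinitesimalGenerator.hasDerivAt_comp (hX : IsInfinitesimalGenerator Φ X₀) {g : M → ℝ}
    (hg : ContMDiff I 𝓘(ℝ, ℝ) ∞ g) (x : M) (t : ℝ) :
    HasDerivAt (fun s => g (Φ.toFun (-s) x)) (-dirDeriv X₀ g (Φ.toFun (-t) x)) t := by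
  set y := Φ.toFun (-t) x with hy
  have h1 : HasDerivAt (fun s => g (Φ.toFun s y)) (dirDeriv X₀ g y) 0 := by
    have key : ∀ (L : E →L[ℝ] ℝ) (u : E) (c : ℝ → ℝ),
        HasFDerivAt c (L.comp ((1 : ℝ →L[ℝ] ℝ).smulRight u)) 0 → HasDerivAt c (L u) 0 :=
      fun L u c h => by simpa using h.hasDerivAt
    have h2 := (hg.mdifferentiable (by simp) (Φ.toFun 0 y)).hasMFDerivAt.comp (0 : ℝ) (hX y)
    have h3 := key _ _ _ h2.hasFDerivAt
    have h4 : dirDeriv X₀ g (Φ.toFun 0 y) = dirDeriv X₀ g y := by rw [Φ.map_zero]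
    exact h4 ▸ h3
  have h2 : HasDerivAt (fun s : ℝ => t - s) (-1) t := by
    simpa using (hasDerivAt_id t).const_sub t
  have h3 : HasDerivAt (fun s => g (Φ.toFun s y)) (dirDeriv X₀ g y) (t - t) := by
    rwa [sub_self]
  have h4 := h3.comp t h2
  have h5 : (fun s => g (Φ.toFun (-s) x)) = (fun s => g (Φ.toFun s y)) ∘ fun s => t - s := by
    ext s
    simp only [Function.comp, hy]
    rw [← Φ.map_add]
    congr 2
    ring
  rw [h5]
  simpa using h4

omit [I.Boundaryless] [IsManifold I ∞ M] in
theorem CircleAction.smoothMotion_neg (Φ : CircleAction I M) :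
    SmoothMotion I fun t => Φ.toFun (-t) where
  smooth := Φ.smooth.comp (contMDiff_fst.neg.prodMk contMDiff_snd)
  invertible t := Φ.smoothMotion.invertible (-t)

omit [I.Boundaryless] [IsManifold I ∞ M] in
theorem IsInfinitesimalGenerator.hasDerivAt_family (hX : IsInfinitesimalGenerator Φ X₀)
    {u u' : ℝ → M → ℝ} (hu : SmoothFamily I u)
    (h : ∀ t x, HasDerivAt (fun s => u s x) (u' t x) t) (t : ℝ) (x : M) :
    HasDerivAt (fun s => u s (Φ.toFun (-s) x))
      (u' t (Φ.toFun (-t) x) - dirDeriv X₀ (u t) (Φ.toFun (-t) x)) t := by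
  have h1 : SmoothFamily 𝓘(ℝ, ℝ) fun s r => u s (Φ.toFun (-r) x) :=
    ContMDiff.comp hu (contMDiff_fst.prodMk
      (Φ.smoothMotion_neg.smooth.comp (contMDiff_snd.prodMk contMDiff_const)))
  have h2 := h1.hasDerivAt_diagonal t
  rw [(h t (Φ.toFun (-t) x)).deriv, (hX.hasDerivAt_comp (hu.contMDiff t) x t).deriv] at h2
  exact h2

theorem IsInfinitesimalGenerator.hasDerivAt_dAt (hX : IsInfinitesimalGenerator Φ X₀)
    (hX' : ContMDiff I I.tangent ∞ (fun m => (X₀ m : TangentBundle I M)))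
    {u u' : ℝ → M → ℝ} (hu : SmoothFamily I u) (hu' : ∀ t, ContMDiff I 𝓘(ℝ, ℝ) ∞ (u' t))
    (h : ∀ t x, HasDerivAt (fun s => u s x) (u' t x) t) (t : ℝ) {x : M} (v : TangentSpace I x) :
    HasDerivAt (fun s => dAt (u s) (mfderiv I I (Φ.toFun (-s)) x v))
      (dAt (fun y => u' t y - dirDeriv X₀ (u t) y) (mfderiv I I (Φ.toFun (-t)) x v)) t := by
  have hd := Φ.smoothMotion_neg.mdifferentiableAt
  have h1 : SmoothFamily I fun s y => u s (Φ.toFun (-s) y) := hu.comp Φ.smoothMotion_neg.smooth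
  have h2 := h1.hasDerivAt_mfderiv t x v
  have h3 : (fun y => deriv (fun s => u s (Φ.toFun (-s) y)) t) =
      fun y => u' t (Φ.toFun (-t) y) - dirDeriv X₀ (u t) (Φ.toFun (-t) y) :=
    funext fun y => (hX.hasDerivAt_family hu h t y).deriv
  have h4 : ∀ s, dAt (u s) (mfderiv I I (Φ.toFun (-s)) x v) =
      dAt (fun y => u s (Φ.toFun (-s) y)) v :=
    fun s => (dAt_comp (hu.contMDiff s) (hd s x) v).symm
  have h5 := dAt_comp ((hu' t).sub (contMDiff_dirDeriv (hu.contMDiff t) hX')) (hd t x) v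
  simp only [h4]
  rw [h3] at h2
  exact h5 ▸ h2

/-- Derivative of a formal tensor `f dg ⊗ dh` transported by the flow. -/
theorem IsInfinitesimalGenerator.hasDerivAt_tri (hX : IsInfinitesimalGenerator Φ X₀)
    (hX' : ContMDiff I I.tangent ∞ (fun m => (X₀ m : TangentBundle I M)))
    {f g h f' g' h' : ℕ → ℝ → M → ℝ} (hf : ∀ n, SmoothFamily I (f n))
    (hg : ∀ n, SmoothFamily I (g n)) (hh : ∀ n, SmoothFamily I (h n))
    (hg' : ∀ n t, ContMDiff I 𝓘(ℝ, ℝ) ∞ (g' n t)) (hh' : ∀ n t, ContMDiff I 𝓘(ℝ, ℝ) ∞ (h' n t))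
    (hf_deriv : ∀ n t x, HasDerivAt (fun s => f n s x) (f' n t x) t)
    (hg_deriv : ∀ n t x, HasDerivAt (fun s => g n s x) (g' n t x) t)
    (hh_deriv : ∀ n t x, HasDerivAt (fun s => h n s x) (h' n t x) t)
    (t : ℝ) {x : M} (v w : TangentSpace I x) (k : ℕ) :
    HasDerivAt (fun s => coeff k (tri (fun n => f n s) (fun n => g n s) (fun n => h n s)
      (mfderiv I I (Φ.toFun (-s)) x v) (mfderiv I I (Φ.toFun (-s)) x w)))
      (coeff k (leib (fun n => f n t) (fun n => g n t) (fun n => h n t) (fun n => f' n t)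
        (fun n => g' n t) (fun n => h' n t)
        (mfderiv I I (Φ.toFun (-t)) x v) (mfderiv I I (Φ.toFun (-t)) x w)) -
      coeff k (leib (fun n => f n t) (fun n => g n t) (fun n => h n t) (act X₀ fun n => f n t)
        (act X₀ fun n => g n t) (act X₀ fun n => h n t)
        (mfderiv I I (Φ.toFun (-t)) x v) (mfderiv I I (Φ.toFun (-t)) x w))) t := by
  have h1 : HasSeriesDerivAt (fun s => ev (fun n => f n s) (Φ.toFun (-s) x))
      (ev (fun n y => f' n t y - act X₀ (fun n => f n t) n y) (Φ.toFun (-t) x)) t := fun n => by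
    simp only [coeff_ev]
    exact hX.hasDerivAt_family (hf n) (hf_deriv n) t x
  have h2 : ∀ {g g' : ℕ → ℝ → M → ℝ}, (∀ n, SmoothFamily I (g n)) →
      (∀ n t, ContMDiff I 𝓘(ℝ, ℝ) ∞ (g' n t)) →
      (∀ n t x, HasDerivAt (fun s => g n s x) (g' n t x) t) → ∀ v : TangentSpace I x,
      HasSeriesDerivAt (fun s => dev (fun n => g n s) (mfderiv I I (Φ.toFun (-s)) x v))
        (dev (fun n y => g' n t y - act X₀ (fun n => g n t) n y)
          (mfderiv I I (Φ.toFun (-t)) x v)) t := by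
    intro g g' hg hg' hd v n
    simp only [coeff_dev]
    exact hX.hasDerivAt_dAt hX' (hg n) (hg' n) (hd n) t v
  have h3 := ((h1.mul (h2 hg hg' hg_deriv v)).mul (h2 hh hh' hh_deriv w)) k
  rw [← map_sub, ← leib_sub (fun n => hg' n t) (fun n => hh' n t)
    (SmoothSeries.act (fun n => (hg n).contMDiff t) hX')
    (SmoothSeries.act (fun n => (hh n).contMDiff t) hX')]
  refine h3.congr_deriv ?_
  congr 1
  simp only [leib, tri]
  ring

end FormalExponential

section Vanishing

open PowerSeries
open Finset.HasAntidiagonal (antidiagonal mem_antidiagonal)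

variable [IsManifold I ∞ M]

/-- The restriction of an expression to a smaller open set. -/
def Expression.restrict {Ω : PresymplecticForm I M Γ} {γ : Γ} {U V : Set M}
    (A : Expression Ω γ U) (hV : IsOpen V) (h : V ⊆ U) : Expression Ω γ V :=
  { A with
    isOpen := hV
    term_eq := fun x hx => A.term_eq x (h hx) }

omit [IsManifold I ∞ M] in
theorem CircleAction.isOpen_core (Φ : CircleAction I M) {U : Set M} (hU : IsOpen U) :
    IsOpen {x | ∀ t, Φ.toFun t x ∈ U} := by
  have h1 : {x | ∀ t, Φ.toFun t x ∈ U} =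
      {x | ∀ t ∈ Set.Icc 0 (2 * Real.pi), Φ.toFun t x ∈ U} := by
    ext x
    refine ⟨fun h t _ => h t, fun h t => ?_⟩
    have hp : Function.Periodic (fun t => Φ.toFun t x) (2 * Real.pi) := fun t => by
      simp only [Φ.map_add, Φ.map_two_pi]
    obtain ⟨s, hs, hst⟩ := hp.exists_mem_Ico₀ Real.two_pi_pos t
    have := h s (Set.Ico_subset_Icc_self hs)
    exact hst ▸ this
  rw [h1, isOpen_iff_mem_nhds]
  intro x hx
  refine isCompact_Icc.eventually_forall_of_forall_eventually fun t ht => ?_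
  have h2 : Continuous fun p : M × ℝ => Φ.toFun p.2 p.1 :=
    Φ.smooth.continuous.comp (continuous_snd.prodMk continuous_fst)
  exact h2.continuousAt (hU.mem_nhds (hx t ht))

variable [I.Boundaryless] [FiniteDimensional ℝ E] [T2Space M]
  {Ω : PresymplecticForm I M Γ} {γ : Γ} {R : ℕ → (m : M) → TangentSpace I m}
  {Φ : CircleAction I M}

omit [IsManifold I ∞ M] [I.Boundaryless] [FiniteDimensional ℝ E] [T2Space M] in
theorem IsPeriodicSolution.smoothSeries {a : ℕ → M → ℝ} {u : ℕ → ℝ → M → ℝ}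
    (hu : IsPeriodicSolution R a u) (t : ℝ) : SmoothSeries I fun n => u n t :=
  fun n => (hu.smooth n).contMDiff t

theorem sub_eq_mul_formalLie
    (hR : ∀ k, ContMDiff I I.tangent ∞ (fun m => (R k m : TangentBundle I M)))
    (hX : IsInfinitesimalGenerator Φ (R 0)) {V : Set M} (hV : ∀ x ∈ V, ∀ t, Φ.toFun t x ∈ V)
    (A : Expression Ω γ V) {f g h : A.ι → ℕ → ℝ → M → ℝ}
    (hf : ∀ i, IsPeriodicSolution R (A.f i) (f i)) (hg : ∀ i, IsPeriodicSolution R (A.g i) (g i))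
    (hh : ∀ i, IsPeriodicSolution R (A.h i) (h i)) {k : ℕ}
    (hk : ∀ (t : ℝ) (x : M) (v w : TangentSpace I x), formalLie Ω γ R k
      (mfderiv I I (Φ.toFun t) x v) (mfderiv I I (Φ.toFun t) x w) = formalLie Ω γ R k v w)
    (hlow : ∀ q < k, ∀ t, ∀ x ∈ V, ∀ v w : TangentSpace I x, Ω.term q γ x v w =
      ∑ i, coeff q (tri (fun n => f i n t) (fun n => g i n t) (fun n => h i n t) v w))
    {x : M} (hx : x ∈ V) (v w : TangentSpace I x) (t : ℝ) :
    ∑ i, coeff k (tri (fun n => f i n t) (fun n => g i n t) (fun n => h i n t)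
      (mfderiv I I (Φ.toFun (-t)) x v) (mfderiv I I (Φ.toFun (-t)) x w)) -
    ∑ i, coeff k (tri (A.f i) (A.g i) (A.h i)
      (mfderiv I I (Φ.toFun (-t)) x v) (mfderiv I I (Φ.toFun (-t)) x w)) =
    t * formalLie Ω γ R k v w := by
  have : CompleteSpace E := FiniteDimensional.complete ℝ E
  let q : ℝ → ℝ := fun t =>
    ∑ i, coeff k (tri (fun n => f i n t) (fun n => g i n t) (fun n => h i n t)
      (mfderiv I I (Φ.toFun (-t)) x v) (mfderiv I I (Φ.toFun (-t)) x w)) -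
    ∑ i, coeff k (tri (A.f i) (A.g i) (A.h i)
      (mfderiv I I (Φ.toFun (-t)) x v) (mfderiv I I (Φ.toFun (-t)) x w))
  have hq : ∀ s, HasDerivAt q (formalLie Ω γ R k v w) s := by
    intro s
    have h1 := HasDerivAt.fun_sum (u := Finset.univ) fun i _ => hX.hasDerivAt_tri (hR 0)
      (hf i).smooth (hg i).smooth (hh i).smooth
      (fun n t => ((hg i).smoothSeries t).formalAct hR n)
      (fun n t => ((hh i).smoothSeries t).formalAct hR n)
      (hf i).hasDerivAt (hg i).hasDerivAt (hh i).hasDerivAt s v w k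
    have h2 := HasDerivAt.fun_sum (u := Finset.univ) fun i _ => hX.hasDerivAt_tri (hR 0)
      (fun n => smoothFamily_const (A.smooth_f i n)) (fun n => smoothFamily_const (A.smooth_g i n))
      (fun n => smoothFamily_const (A.smooth_h i n))
      (g' := fun _ _ _ => 0) (h' := fun _ _ _ => 0) (f' := fun _ _ _ => 0)
      (fun n t => contMDiff_const) (fun n t => contMDiff_const)
      (fun n t x => hasDerivAt_const t _) (fun n t x => hasDerivAt_const t _)
      (fun n t x => hasDerivAt_const t _) s v w k
    refine (h1.sub h2).congr_deriv ?_
    set y := Φ.toFun (-s) x with hy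
    have hyV : y ∈ V := hV x hx (-s)
    rw [← hk (-s)]
    set v' : TangentSpace I y := mfderiv I I (Φ.toFun (-s)) x v
    set w' : TangentSpace I y := mfderiv I I (Φ.toFun (-s)) x w
    let T : ℕ × ℕ → ℝ := fun p => ∑ i, coeff p.2 (leib (fun n => f i n s) (fun n => g i n s)
      (fun n => h i n s) (act (R p.1) fun n => f i n s) (act (R p.1) fun n => g i n s)
      (act (R p.1) fun n => h i n s) v' w')
    let S : ℕ × ℕ → ℝ := fun p => lieDeriv (R p.1) (Ω.term p.2 γ) (extend v') (extend w') y
    have h3 : ∀ p ∈ (antidiagonal k).erase (0, k), T p = S p := by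
      intro p hp
      rw [Finset.mem_erase, mem_antidiagonal] at hp
      have hpk : p.2 < k := by
        rcases p with ⟨i, j⟩
        have : i ≠ 0 := by
          rintro rfl
          simp_all
        simp only at hp
        simp only
        omega
      have h4 := lieDeriv_eq_leib (fun i => (hf i).smoothSeries s) (fun i => (hg i).smoothSeries s)
        (fun i => (hh i).smoothSeries s) (hR p.1) (τ := Ω.term p.2 γ) (m := y) (k := p.2)
        (by filter_upwards [A.isOpen.mem_nhds hyV] with z hz using hlow p.2 hpk s z hz)
        (extend v') (extend w')
      rw [extend_apply, extend_apply] at h4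
      exact h4.symm
    have h4 : S (0, k) = ∑ i, coeff k (leib (A.f i) (A.g i) (A.h i) (act (R 0) (A.f i))
        (act (R 0) (A.g i)) (act (R 0) (A.h i)) v' w') := by
      have h5 := lieDeriv_eq_leib A.smooth_f A.smooth_g A.smooth_h (hR 0) (τ := Ω.term k γ)
        (m := y) (k := k)
        (by filter_upwards [A.isOpen.mem_nhds hyV] with z hz using A.term_eq z hz k)
        (extend v') (extend w')
      rw [extend_apply, extend_apply] at h5
      exact h5
    have h5 : ∑ i, coeff k (leib (fun n => f i n s) (fun n => g i n s)
        (fun n => h i n s) (formalAct R fun n => f i n s) (formalAct R fun n => g i n s)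
        (formalAct R fun n => h i n s) v' w') = ∑ p ∈ antidiagonal k, T p := by
      simp only [coeff_leib_formalAct ((hg _).smoothSeries s) ((hh _).smoothSeries s) hR]
      exact Finset.sum_comm
    have hmem : (0, k) ∈ antidiagonal k := by simp
    have h6 : formalLie Ω γ R k v' w' = ∑ p ∈ antidiagonal k, S p := rfl
    rw [Finset.sum_sub_distrib, Finset.sum_sub_distrib, h6, ← Finset.add_sum_erase _ S hmem,
      ← Finset.sum_congr rfl h3, h4]
    simp only [leib_zero, map_zero, Finset.sum_const_zero, zero_sub, sub_neg_eq_add]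
    refine Eq.trans (congrArg (fun r => r - T (0, k) + _)
      (h5.trans (Finset.add_sum_erase _ T hmem).symm)) ?_
    ring
  have h0 : q 0 = 0 := by
    have e1 : ∀ i, (fun n => f i n 0) = A.f i := fun i => funext fun n => funext ((hf i).zero n)
    have e2 : ∀ i, (fun n => g i n 0) = A.g i := fun i => funext fun n => funext ((hg i).zero n)
    have e3 : ∀ i, (fun n => h i n 0) = A.h i := fun i => funext fun n => funext ((hh i).zero n)
    simp only [q, e1, e2, e3, sub_self]
  have h1 : ∀ s, HasDerivAt (fun s => q s - s * formalLie Ω γ R k v w) 0 s := fun s =>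
    ((hq s).fun_sub ((hasDerivAt_id s).mul_const (formalLie Ω γ R k v w))).congr_deriv (by simp)
  have h2 := is_const_of_deriv_eq_zero (fun s => (h1 s).differentiableAt)
    (fun s => (h1 s).deriv) t 0
  simp only [h0, zero_mul, sub_zero] at h2
  exact sub_eq_zero.1 h2

theorem formalLie_eq_zero
    (hR : ∀ k, ContMDiff I I.tangent ∞ (fun m => (R k m : TangentBundle I M)))
    (hX : IsInfinitesimalGenerator Φ (R 0))
    (hexp : ∀ a : ℕ → M → ℝ, SmoothSeries I a → ∃ u, IsPeriodicSolution R a u) {n : ℕ}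
    (hn : ∀ (t : ℝ) (x : M) (v w : TangentSpace I x), formalLie Ω γ R n
      (mfderiv I I (Φ.toFun t) x v) (mfderiv I I (Φ.toFun t) x w) = formalLie Ω γ R n v w)
    (hlow : ∀ j < n, ∀ (x : M) (v w : TangentSpace I x), formalLie Ω γ R j v w = 0)
    {x : M} (v w : TangentSpace I x) : formalLie Ω γ R n v w = 0 := by
  obtain ⟨B⟩ := nonempty_representation Ω γ (Φ.isCompact_orbit x)
  let V : Set M := {x | ∀ t, Φ.toFun t x ∈ B.domain}
  have hxV : x ∈ V := fun t => B.subset_domain ⟨t, rfl⟩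
  have hV : ∀ x ∈ V, ∀ t, Φ.toFun t x ∈ V := fun x hx t s => by
    rw [← Φ.map_add]
    exact hx _
  have hVB : V ⊆ B.domain := fun x hx => by
    have := hx 0
    rwa [Φ.map_zero] at this
  let A := B.expression.restrict (Φ.isOpen_core B.isOpen_domain) hVB
  choose f hf using fun i => hexp (A.f i) (A.smooth_f i)
  choose g hg using fun i => hexp (A.g i) (A.smooth_g i)
  choose h hh using fun i => hexp (A.h i) (A.smooth_h i)
  have key : ∀ k < n, ∀ t, ∀ x ∈ V, ∀ v w : TangentSpace I x, Ω.term k γ x v w =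
      ∑ i, coeff k (tri (fun n => f i n t) (fun n => g i n t) (fun n => h i n t) v w) := by
    intro k
    induction k using Nat.strong_induction_on with
    | _ k ih =>
      intro hk t y hy v w
      obtain ⟨x, rfl⟩ : ∃ x, Φ.toFun (-t) x = y :=
        ⟨Φ.toFun t y, by rw [← Φ.map_add, neg_add_cancel, Φ.map_zero]⟩
      have hx : x ∈ V := by
        have := hV _ hy t
        rwa [← Φ.map_add, add_neg_cancel, Φ.map_zero] at this
      obtain ⟨v, rfl⟩ := (Φ.smoothMotion.invertible (-t) x).surjective v
      obtain ⟨w, rfl⟩ := (Φ.smoothMotion.invertible (-t) x).surjective w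
      have h1 := sub_eq_mul_formalLie hR hX hV A hf hg hh
        (fun t x v w => by rw [hlow k hk, hlow k hk])
        (fun q hq => ih q hq (hq.trans hk)) hx v w t
      rw [hlow k hk, mul_zero, sub_eq_zero] at h1
      rw [h1]
      exact A.term_eq _ hy k _ _
  have h1 := sub_eq_mul_formalLie hR hX hV A hf hg hh hn key hxV v w (2 * Real.pi)
  have e1 : ∀ i, (fun n => f i n (2 * Real.pi)) = A.f i :=
    fun i => funext fun n => funext ((hf i).two_pi n)
  have e2 : ∀ i, (fun n => g i n (2 * Real.pi)) = A.g i :=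
    fun i => funext fun n => funext ((hg i).two_pi n)
  have e3 : ∀ i, (fun n => h i n (2 * Real.pi)) = A.h i :=
    fun i => funext fun n => funext ((hh i).two_pi n)
  simp only [e1, e2, e3, sub_self] at h1
  exact (mul_eq_zero.1 h1.symm).resolve_left Real.two_pi_pos.ne'

omit [IsManifold I ∞ M] [I.Boundaryless] [FiniteDimensional ℝ E] [T2Space M] in
theorem NearlyPeriodicMap.smoothMotion (F : NearlyPeriodicMap I M Γ) (γ : Γ) :
    SmoothMotion I fun s => F.at' (s • γ) where
  smooth := F.smooth.comp (contMDiff_snd.prodMk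
    ((contDiff_id.smul contDiff_const :
        ContDiff ℝ ∞ fun s : ℝ => s • γ).contMDiff.comp contMDiff_fst))
  invertible s x := by
    obtain ⟨g, hg⟩ := F.diffeo (s • γ)
    have h1 : F.at' (s • γ) = g := funext fun m => (hg m).symm
    rw [h1]
    exact ⟨g.mfderivToContinuousLinearEquiv (by simp) x, rfl⟩

theorem formalLie_rotoRate_eq_zero {F : NearlyPeriodicMap I M Γ} (hF : F.NonResonant)
    (hΩ : IsPresymplecticMap F Ω) {R : FormalVectorField I M Γ} (hR : IsRotoRate F R) (γ : Γ)
    (n : ℕ) (x : M) (v w : TangentSpace I x) :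
    formalLie Ω γ (fun k => R.term k γ) n v w = 0 := by
  induction n using Nat.strong_induction_on generalizing x with
  | _ n ih =>
    have hs : ∀ k, ContMDiff I I.tangent ∞ (fun m => (R.term k γ m : TangentBundle I M)) :=
      fun k => (R k fun _ => γ).contMDiff
    have h0 : F.at' ((0 : ℝ) • γ) = F.action.toFun F.angle := by
      rw [zero_smul]
      exact funext F.map_zero
    refine formalLie_eq_zero hs (hR.limiting γ)
      (fun a ha => exists_isPeriodicSolution hR.periodic γ ha)
      (fun t x v w => formalLie_flow hs F.action hF (fun x v w => ?_) t v w) ih v w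
    rw [← h0]
    exact formalLie_pull hs (F.smoothMotion γ) (fun n x => hR.invariant n γ x)
      (fun s x v w => hΩ (s • γ) x v w) ih v w

end Vanishing

end NearlyPeriodic

end

theorem mainTheorem3
    {E : Type*} [NormedAddCommGroup E] [NormedSpace ℝ E] [FiniteDimensional ℝ E]
    {H : Type*} [TopologicalSpace H] (I : ModelWithCorners ℝ E H) [I.Boundaryless]
    (M : Type*) [TopologicalSpace M] [ChartedSpace H M] [IsManifold I ∞ M] [T2Space M]
    (Γ : Type*) [NormedAddCommGroup Γ] [NormedSpace ℝ Γ]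
    (Ω : NearlyPeriodic.PresymplecticForm I M Γ)
    (F : NearlyPeriodic.NearlyPeriodicMap I M Γ)
    (hF : F.NonResonant) (hΩ : NearlyPeriodic.IsPresymplecticMap F Ω)
    (R : NearlyPeriodic.FormalVectorField I M Γ) (hR : NearlyPeriodic.IsRotoRate F R) :
    NearlyPeriodic.FormalLieDerivEqZero R Ω := by
  intro n γ Y Z m
  have h1 := NearlyPeriodic.sum_lieDeriv_eq_formalLie (Ω := Ω) (γ := γ)
    (R := fun k => R.term k γ) (fun k => (R k fun _ => γ).contMDiff) n m Y Z
  exact h1.trans (NearlyPeriodic.formalLie_rotoRate_eq_zero hF hΩ hR γ n m _ _)
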